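/- Let $n\ge 0$ be an integer and let each $T\in SL(n+1,\mathbb R)$ act on the unit sphere $\mathbb S^n\subset\mathbb R^{n+1}$ (with the Euclidean norm) by the homeomorphism $\overline T(x)=T(x)/\|T(x)\|$. A semigroup $\mathfrak S\subset SL(n+1,\mathbb R)$ is said to act distally on $\mathbb S^n$ if for every pair of distinct points $x,y\in\mathbb S^n$ the closure of $\{(\overline T(x),\overline T(y)) : T\in\mathfrak S\}$ in $\mathbb S^n\times\mathbb S^n$ does not intersect the diagonal $\{(d,d): d\in\mathbb S^n\}$. A cyclic subsemigroup of $\mathfrak S$ is one of the form $\{T^m : m\ge 1\}$ with $T\in\mathfrak S$. Let $\mathfrak S$ be a closed semigroup of $SL(n+1,\mathbb R)$. Then $\mathfrak S$ acts distally on $\mathbb S^n$ if and only if every cyclic subsemigroup of $\mathfrak S$ acts distally on $\mathbb S^n$. -/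

import Mathlib

open scoped MatrixGroups

/-- A semigroup `S` of homeomorphisms of a topological space `X` acts distally on `X` if, for all
distinct `x, y`, the closure of `{(T x, T y) | T ∈ S}` in `X × X` does not meet the diagonal. -/
def ActsDistally {X : Type*} [TopologicalSpace X] (S : Subsemigroup (X ≃ₜ X)) : Prop :=
  ∀ x y : X, x ≠ y →
    Disjoint (closure {p : X × X | ∃ T ∈ S, p = (T x, T y)}) (Set.diagonal X)

/-- A subsemigroup is cyclic if it is generated, as a semigroup, by one element `T`,
that is, it is `{T ^ m | m ≥ 1}`. -/
def IsCyclicSubsemigroup {M : Type*} [Mul M] (C : Subsemigroup M) : Prop :=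
  ∃ T : M, C = Subsemigroup.closure {T}

/-- The unit sphere of Euclidean space `ℝ ^ (n + 1)`. -/
abbrev UnitSphere (n : ℕ) : Type :=
  Metric.sphere (0 : EuclideanSpace ℝ (Fin (n + 1))) 1

theorem toEuclideanLin_GL_mul {n : ℕ} (A B : GL (Fin (n + 1)) ℝ)
    (v : EuclideanSpace ℝ (Fin (n + 1))) :
    Matrix.toEuclideanLin (A * B : GL (Fin (n + 1)) ℝ).val v =
      Matrix.toEuclideanLin A.val (Matrix.toEuclideanLin B.val v) := by
  simp [Matrix.toLpLin_apply]

theorem toEuclideanLin_GL_one {n : ℕ} (v : EuclideanSpace ℝ (Fin (n + 1))) :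
    Matrix.toEuclideanLin (1 : GL (Fin (n + 1)) ℝ).val v = v := by
  simp

theorem toEuclideanLin_GL_ne_zero {n : ℕ} (T : GL (Fin (n + 1)) ℝ)
    {v : EuclideanSpace ℝ (Fin (n + 1))} (hv : v ≠ 0) :
    Matrix.toEuclideanLin T.val v ≠ 0 := by
  intro h
  apply hv
  have h2 := toEuclideanLin_GL_mul T⁻¹ T v
  rwa [inv_mul_cancel, toEuclideanLin_GL_one, h, map_zero] at h2

theorem UnitSphere.ne_zero {n : ℕ} (x : UnitSphere n) : x.val ≠ 0 :=
  ne_zero_of_mem_unit_sphere x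

/-- The map `x ↦ T x / ‖T x‖` of the unit sphere to itself, for `T` in `GL(n + 1, ℝ)`. -/
noncomputable def sphereMap {n : ℕ} (T : GL (Fin (n + 1)) ℝ) (x : UnitSphere n) : UnitSphere n :=
  ⟨‖Matrix.toEuclideanLin T.val x.val‖⁻¹ • Matrix.toEuclideanLin T.val x.val, by
    rw [mem_sphere_zero_iff_norm]
    exact norm_smul_inv_norm (𝕜 := ℝ) (toEuclideanLin_GL_ne_zero T x.ne_zero)⟩

theorem sphereMap_one {n : ℕ} (x : UnitSphere n) : sphereMap 1 x = x := by
  apply Subtype.ext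
  have hx : ‖x.val‖ = 1 := norm_eq_of_mem_sphere x
  simp only [sphereMap, toEuclideanLin_GL_one, hx, inv_one, one_smul]

theorem sphereMap_mul {n : ℕ} (A B : GL (Fin (n + 1)) ℝ) (x : UnitSphere n) :
    sphereMap (A * B) x = sphereMap A (sphereMap B x) := by
  apply Subtype.ext
  have hB : ‖Matrix.toEuclideanLin B.val x.val‖ ≠ 0 :=
    norm_ne_zero_iff.mpr (toEuclideanLin_GL_ne_zero B x.ne_zero)
  simp only [sphereMap, toEuclideanLin_GL_mul, map_smul, norm_smul, norm_inv, norm_norm, smul_smul,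
    mul_inv, inv_inv]
  congr 1
  field_simp

theorem continuous_sphereMap {n : ℕ} (T : GL (Fin (n + 1)) ℝ) :
    Continuous (sphereMap T : UnitSphere n → UnitSphere n) := by
  have h : Continuous fun x : UnitSphere n => Matrix.toEuclideanLin T.val x.val :=
    (LinearMap.continuous_of_finiteDimensional _).comp continuous_subtype_val
  exact Continuous.subtype_mk ((h.norm.inv₀ fun x =>
    norm_ne_zero_iff.mpr (toEuclideanLin_GL_ne_zero T x.ne_zero)).smul h) _

/-- The canonical action of `GL(n + 1, ℝ)` on the unit sphere by the homeomorphisms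
`x ↦ T x / ‖T x‖`. -/
noncomputable def sphereAction (n : ℕ) : GL (Fin (n + 1)) ℝ →* (UnitSphere n ≃ₜ UnitSphere n) where
  toFun T :=
    { toFun := sphereMap T
      invFun := sphereMap T⁻¹
      left_inv := fun x => by rw [← sphereMap_mul, inv_mul_cancel, sphereMap_one]
      right_inv := fun x => by rw [← sphereMap_mul, mul_inv_cancel, sphereMap_one]
      continuous_toFun := continuous_sphereMap T
      continuous_invFun := continuous_sphereMap T⁻¹ }
  map_one' := Homeomorph.ext sphereMap_one
  map_mul' A B := Homeomorph.ext (sphereMap_mul A B)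

/-- A semigroup `S` in `SL(n + 1, ℝ)` acts distally on the unit sphere if the semigroup of
homeomorphisms of the sphere that it induces through the canonical action does. -/
def ActsDistallyOnSphere {n : ℕ} (S : Subsemigroup SL(n + 1, ℝ)) : Prop :=
  ActsDistally (S.map ((sphereAction n).comp Matrix.SpecialLinearGroup.toGL).toMulHom)

/-!
A semigroup of `SL(n + 1, ℝ)` acts distally on the sphere if it is bounded, because then the closure
of an orbit of pairs is swept out by a compact set of homeomorphisms, and only if it is bounded
(`ActsDistallyOnSphere.bounded`): normalized elements of an unbounded semigroup accumulate at a
nonzero singular matrix, which brings the directions of two distinct points together.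
So all elements of `S` have bounded powers when its cyclic subsemigroups act distally. As `S` is
closed, it then contains the inverses of its elements and is a group (if not empty). What remains is
`exists_norm_le_of_isElliptic`: a closed linear group `G` is bounded if each of its elements is
elliptic, that is, generates a bounded cyclic group. For groups that are not closed this fails.

An elliptic element preserves a Euclidean norm, so its trace is at most the dimension in absolute
value, with trace equal to the dimension only for the identity. By the nondegeneracy of the trace
form, a completely reducible group of elliptic elements is bounded
(`weaklyBounded_range_of_trace_bounded`). In general this gives an isometric semisimplification `p`
of `G`, to which finite subsets of `G` can be conjugated as closely as desired. The elements of `G`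
with `p g` near the identity generate a subgroup `N` of finite index, and it suffices to find an
invariant projection onto each `N`-invariant subspace `W`, that is, an invariant vector on an affine
hyperplane `ℓ = 1` in a representation of `N`. By dimension, it suffices to do so for finitely many
generators `F` of `N` at a time (`IsIsometricSemisimplification.exists_commute_finset`).

Here closedness enters. It makes `p` an immersion at the identity of `G`, and therefore `F`
normalizes a small neighborhood `B` of the identity. The elements of `F` are conjugate to elements
near the identity, where commutators contract; so their iterated commutators end up in `B`. Thus `F`
and `B` generate a group that is nilpotent modulo elements with bounded conjugacy class. An element
`s` with bounded conjugacy class is dealt with by averaging (`exists_subrepresentation_fixed_by`):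
the hull of its conjugacy class contains an operator `P` that commutes with the group, and a
comparison of traces shows that `s` is the identity on the generalized eigenspace of `P` for the
eigenvalue `1`, on which `ℓ` does not vanish.
-/

/-! ### Weak boundedness and fixed points of bounded linear groups -/

/-- A subset of a real vector space is weakly bounded if every linear functional is bounded on it.
In finite dimension this is boundedness for any norm; stated this way it passes to subspaces and
quotients without a choice of norm. -/
def WeaklyBounded {E : Type*} [AddCommGroup E] [Module ℝ E] (s : Set E) : Prop :=
  ∀ φ : Module.Dual ℝ E, ∃ C : ℝ, ∀ x ∈ s, |φ x| ≤ C

section WeaklyBounded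

variable {E F : Type*} [AddCommGroup E] [Module ℝ E] [AddCommGroup F] [Module ℝ F]

theorem WeaklyBounded.mono {s t : Set E} (ht : WeaklyBounded t) (h : s ⊆ t) : WeaklyBounded s :=
  fun φ => (ht φ).imp fun _ hC x hx => hC x (h hx)

theorem WeaklyBounded.image {s : Set E} (hs : WeaklyBounded s) (f : E →ₗ[ℝ] F) :
    WeaklyBounded (f '' s) := by
  intro φ
  obtain ⟨C, hC⟩ := hs (φ ∘ₗ f)
  refine ⟨C, ?_⟩
  rintro _ ⟨x, hx, rfl⟩
  exact hC x hx

theorem WeaklyBounded.of_map_injective {f : E →ₗ[ℝ] F} (hf : Function.Injective f) {s : Set E}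
    (hs : WeaklyBounded (f '' s)) : WeaklyBounded s := by
  intro φ
  obtain ⟨g, hg⟩ := f.exists_leftInverse_of_injective (LinearMap.ker_eq_bot.mpr hf)
  obtain ⟨C, hC⟩ := hs (φ ∘ₗ g)
  refine ⟨C, fun x hx => ?_⟩
  have := hC (f x) ⟨x, hx, rfl⟩
  have h2 : g (f x) = x := LinearMap.congr_fun hg x
  simpa [h2] using this

/-- It suffices to bound a family of functionals that separates points, since such a family spans
the dual space. -/
theorem weaklyBounded_of_separating [FiniteDimensional ℝ E] {s : Set E}
    (𝓕 : Set (Module.Dual ℝ E)) (hsep : ∀ x, (∀ φ ∈ 𝓕, φ x = 0) → x = 0)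
    (hb : ∀ φ ∈ 𝓕, ∃ C : ℝ, ∀ x ∈ s, |φ x| ≤ C) : WeaklyBounded s := by
  let B : Submodule ℝ (Module.Dual ℝ E) :=
    { carrier := {φ | ∃ C : ℝ, ∀ x ∈ s, |φ x| ≤ C}
      zero_mem' := ⟨0, by simp⟩
      add_mem' := by
        rintro φ ψ ⟨C, hC⟩ ⟨D, hD⟩
        exact ⟨C + D, fun x hx => (abs_add_le _ _).trans (add_le_add (hC x hx) (hD x hx))⟩
      smul_mem' := by
        rintro r φ ⟨C, hC⟩
        refine ⟨|r| * C, fun x hx => ?_⟩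
        simp only [LinearMap.smul_apply, smul_eq_mul, abs_mul]
        exact mul_le_mul_of_nonneg_left (hC x hx) (abs_nonneg r) }
  have h1 : B.dualCoannihilator = ⊥ := by
    rw [eq_bot_iff]
    intro x hx
    rw [Submodule.mem_dualCoannihilator] at hx
    exact hsep x fun φ hφ => hx φ (hb φ hφ)
  have h2 : B = ⊤ := by
    rw [← Subspace.dualCoannihilator_dualAnnihilator_eq (W := B), h1,
      Submodule.dualAnnihilator_bot]
  intro φ
  have : φ ∈ B := h2 ▸ Submodule.mem_top
  exact this

theorem weaklyBounded_end [FiniteDimensional ℝ E] [FiniteDimensional ℝ F] {s : Set (E →ₗ[ℝ] F)}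
    (h : ∀ x, WeaklyBounded ((fun T : E →ₗ[ℝ] F => T x) '' s)) : WeaklyBounded s := by
  refine weaklyBounded_of_separating
    {φ | ∃ (x : E) (ψ : Module.Dual ℝ F), φ = ψ ∘ₗ LinearMap.applyₗ x} ?_ ?_
  · intro T hT
    ext x
    refine (Module.forall_dual_apply_eq_zero_iff ℝ _).mp fun ψ => ?_
    exact hT _ ⟨x, ψ, rfl⟩
  · rintro _ ⟨x, ψ, rfl⟩
    obtain ⟨C, hC⟩ := h x ψ
    exact ⟨C, fun T hT => hC _ ⟨T, hT, rfl⟩⟩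

theorem weaklyBounded_of_norm {E : Type*} [NormedAddCommGroup E] [NormedSpace ℝ E]
    [FiniteDimensional ℝ E] {s : Set E} {C : ℝ} (h : ∀ x ∈ s, ‖x‖ ≤ C) : WeaklyBounded s := by
  intro φ
  let ψ : E →L[ℝ] ℝ := LinearMap.toContinuousLinearMap φ
  refine ⟨‖ψ‖ * C, fun x hx => ?_⟩
  have := ψ.le_opNorm x
  exact this.trans (mul_le_mul_of_nonneg_left (h x hx) (norm_nonneg _))

theorem WeaklyBounded.exists_norm_le {E : Type*} [NormedAddCommGroup E] [NormedSpace ℝ E]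
    [FiniteDimensional ℝ E] {s : Set E} (h : WeaklyBounded s) : ∃ C : ℝ, ∀ x ∈ s, ‖x‖ ≤ C := by
  let b := Module.finBasis ℝ E
  choose C hC using fun i => h (b.coord i)
  refine ⟨∑ i, C i * ‖b i‖, fun x hx => ?_⟩
  conv_lhs => rw [← b.sum_repr x]
  refine (norm_sum_le _ _).trans (Finset.sum_le_sum fun i _ => ?_)
  rw [norm_smul]
  exact mul_le_mul_of_nonneg_right (hC i x hx) (norm_nonneg _)

end WeaklyBounded

section FixedPoint

variable {H : Type*} [Group H]

theorem exists_fixed_of_bounded_orbit_inner {E : Type*} [NormedAddCommGroup E]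
    [InnerProductSpace ℝ E] [FiniteDimensional ℝ E] (ρ : Representation ℝ H E) (x₀ : E)
    (hb : WeaklyBounded (Set.range fun h => ρ h x₀)) :
    ∃ x, (∀ h, ρ h x = x) ∧
      ∀ (φ : Module.Dual ℝ E) (c : ℝ), (∀ h, c ≤ φ (ρ h x₀)) → c ≤ φ x := by
  set A : Set E := {x | ∀ (φ : Module.Dual ℝ E) (c : ℝ), (∀ h, c ≤ φ (ρ h x₀)) → c ≤ φ x} with hA
  have hx₀ : x₀ ∈ A := fun φ c h => by simpa using h 1
  have hinv : ∀ h, ∀ x ∈ A, ρ h x ∈ A := by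
    intro h x hx φ c hc
    refine hx (φ ∘ₗ ρ h) c fun g => ?_
    have := hc (h * g)
    simpa [map_mul] using this
  have hclosed : IsClosed A := by
    have : A = ⋂ (φ : Module.Dual ℝ E) (c : ℝ) (_ : ∀ h, c ≤ φ (ρ h x₀)), {x | c ≤ φ x} := by
      ext x; simp [hA]
    rw [this]
    refine isClosed_iInter fun φ => isClosed_iInter fun c => isClosed_iInter fun _ => ?_
    exact isClosed_le continuous_const φ.continuous_of_finiteDimensional
  have hmid : ∀ x ∈ A, ∀ y ∈ A, (1 / 2 : ℝ) • (x + y) ∈ A := by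
    intro x hx y hy φ c hc
    have h1 := hx φ c hc
    have h2 := hy φ c hc
    simp only [map_smul, map_add, smul_eq_mul]
    linarith
  have hAb : WeaklyBounded A := by
    intro φ
    obtain ⟨C, hC⟩ := hb φ
    refine ⟨C, fun x hx => abs_le.mpr ⟨?_, ?_⟩⟩
    · exact hx φ (-C) fun h => (abs_le.mp (hC _ ⟨h, rfl⟩)).1
    · have := hx (-φ) (-C) fun h => by
        have := (abs_le.mp (hC _ ⟨h, rfl⟩)).2
        simpa using this
      simpa using this
  obtain ⟨C, hC⟩ := hAb.exists_norm_le
  have hcomp : IsCompact A := by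
    refine Metric.isCompact_of_isClosed_isBounded hclosed ?_
    exact isBounded_iff_forall_norm_le.mpr ⟨C, hC⟩
  -- The group is uniformly bounded on the subspace of vectors with bounded orbit.
  let L : Submodule ℝ E :=
    { carrier := {x | ∃ C : ℝ, ∀ h, ‖ρ h x‖ ≤ C}
      zero_mem' := ⟨0, by simp⟩
      add_mem' := by
        rintro x y ⟨a, ha⟩ ⟨b, hb⟩
        refine ⟨a + b, fun h => ?_⟩
        rw [map_add]
        exact (norm_add_le _ _).trans (add_le_add (ha h) (hb h))
      smul_mem' := by
        rintro r x ⟨a, ha⟩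
        refine ⟨|r| * a, fun h => ?_⟩
        rw [map_smul, norm_smul]
        exact mul_le_mul_of_nonneg_left (ha h) (abs_nonneg r) }
  have hL : ∀ h, ∀ x ∈ L, ρ h x ∈ L := by
    rintro h x ⟨a, ha⟩
    exact ⟨a, fun g => by simpa [map_mul] using ha (g * h)⟩
  have hAL : ∀ x ∈ A, x ∈ L := fun x hx => ⟨C, fun h => hC _ (hinv h x hx)⟩
  obtain ⟨M, hM⟩ := banach_steinhaus
    (g := fun h => LinearMap.toContinuousLinearMap ((ρ h) ∘ₗ L.subtype))
    (fun x => x.2)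
  have hM' : ∀ h, ∀ x ∈ L, ‖ρ h x‖ ≤ M * ‖x‖ := by
    intro h x hx
    have := (LinearMap.toContinuousLinearMap ((ρ h) ∘ₗ L.subtype)).le_of_opNorm_le (hM h) ⟨x, hx⟩
    simpa using this
  have hlow : ∀ h, ∀ x ∈ L, ‖x‖ ≤ M * ‖ρ h x‖ := by
    intro h x hx
    have := hM' h⁻¹ _ (hL h x hx)
    rwa [← Module.End.mul_apply, ← map_mul, inv_mul_cancel, map_one, Module.End.one_apply] at this
  have hM0 : 0 ≤ M := (norm_nonneg _).trans (hM 1)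
  -- The strictly convex invariant function to be minimized.
  let f : E → ℝ := fun x => ⨆ h, ‖ρ h x‖ ^ 2
  have hbdd : ∀ x ∈ A, BddAbove (Set.range fun h => ‖ρ h x‖ ^ 2) := by
    intro x hx
    refine ⟨C ^ 2, ?_⟩
    rintro _ ⟨h, rfl⟩
    exact pow_le_pow_left₀ (norm_nonneg _) (hC _ (hinv h x hx)) 2
  have hfle : ∀ x ∈ A, ∀ h, ‖ρ h x‖ ^ 2 ≤ f x := fun x hx h => le_ciSup (hbdd x hx) h
  have hlsc : LowerSemicontinuousOn f A := by
    refine lowerSemicontinuousOn_ciSup hbdd fun h => ?_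
    exact (((ρ h).continuous_of_finiteDimensional.norm.pow 2)).continuousOn.lowerSemicontinuousOn
  obtain ⟨x, hxA, hmin⟩ := hlsc.exists_isMinOn ⟨x₀, hx₀⟩ hcomp
  refine ⟨x, fun g => ?_, hxA⟩
  have hyA := hinv g x hxA
  set y := ρ g x with hy
  have hfy : f y ≤ f x := by
    refine ciSup_le fun h => ?_
    have := hfle x hxA (h * g)
    simpa [map_mul, hy] using this
  have hzL : x - y ∈ L := L.sub_mem (hAL x hxA) (hAL y hyA)
  have key : ∀ h, ‖ρ h ((1 / 2 : ℝ) • (x + y))‖ ^ 2 ≤ f x - (‖ρ h (x - y)‖ / 2) ^ 2 := by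
    intro h
    have h1 := hfle x hxA h
    have h2 := (hfle y hyA h).trans hfy
    have h3 := parallelogram_law_with_norm ℝ (ρ h x) (ρ h y)
    rw [map_smul, norm_smul, map_add, map_sub]
    norm_num
    nlinarith
  have hw : f x ≤ f ((1 / 2 : ℝ) • (x + y)) := hmin (hmid x hxA y hyA)
  by_contra hne
  have hne' : 0 < ‖x - y‖ := norm_pos_iff.mpr (sub_ne_zero.mpr fun h => hne h.symm)
  have hMpos : 0 < M := by
    rcases hM0.lt_or_eq with h | h
    · exact h
    · have := hlow 1 _ hzL
      rw [← h] at this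
      linarith
  have hup : f ((1 / 2 : ℝ) • (x + y)) ≤ f x - (‖x - y‖ / M / 2) ^ 2 := by
    refine ciSup_le fun h => (key h).trans ?_
    have h4 : ‖x - y‖ / M ≤ ‖ρ h (x - y)‖ := by
      rw [div_le_iff₀ hMpos, mul_comm]
      exact hlow h _ hzL
    have h5 : 0 ≤ ‖x - y‖ / M := by positivity
    have : (‖x - y‖ / M / 2) ^ 2 ≤ (‖ρ h (x - y)‖ / 2) ^ 2 :=
      pow_le_pow_left₀ (by positivity) (by linarith) 2
    linarith
  have : 0 < (‖x - y‖ / M / 2) ^ 2 := by positivity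
  linarith

/-- A vector with bounded orbit under a linear group has a fixed point in the closed convex hull of
its orbit; the hull is described by the closed half-spaces containing the orbit.
The fixed point minimizes the invariant function `x ↦ sup ‖h x‖ ^ 2`, which is strictly convex
because the group is uniformly bounded on the span of the orbit. -/
theorem exists_fixed_of_bounded_orbit {E : Type*} [AddCommGroup E] [Module ℝ E]
    [FiniteDimensional ℝ E] (ρ : Representation ℝ H E) (x₀ : E)
    (hb : WeaklyBounded (Set.range fun h => ρ h x₀)) :
    ∃ x, (∀ h, ρ h x = x) ∧
      ∀ (φ : Module.Dual ℝ E) (c : ℝ), (∀ h, c ≤ φ (ρ h x₀)) → c ≤ φ x := by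
  let e : E ≃ₗ[ℝ] EuclideanSpace ℝ (Fin (Module.finrank ℝ E)) :=
    (Module.finBasis ℝ E).equivFun ≪≫ₗ (WithLp.linearEquiv 2 ℝ _).symm
  let ρ' : Representation ℝ H (EuclideanSpace ℝ (Fin (Module.finrank ℝ E))) :=
    { toFun := fun h => e.toLinearMap ∘ₗ ρ h ∘ₗ e.symm.toLinearMap
      map_one' := by ext1 x; simp
      map_mul' := fun a b => by ext1 x; simp }
  have hρ' : ∀ h x, ρ' h (e x) = e (ρ h x) := fun h x => by simp [ρ']
  obtain ⟨y, hy, hy2⟩ := exists_fixed_of_bounded_orbit_inner ρ' (e x₀) (by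
    refine (hb.image e.toLinearMap).mono ?_
    rintro _ ⟨h, rfl⟩
    exact ⟨_, ⟨h, rfl⟩, (hρ' h x₀).symm⟩)
  refine ⟨e.symm y, fun h => ?_, fun φ c hc => ?_⟩
  · apply e.injective
    rw [← hρ', e.apply_symm_apply, hy]
  · exact hy2 (φ ∘ₗ e.symm.toLinearMap) c fun h => by simpa [hρ'] using hc h

end FixedPoint

/-! ### Bounded representations and elliptic elements -/

section BoundedRepresentation

theorem WeaklyBounded.apply {E F : Type*} [AddCommGroup E] [Module ℝ E] [AddCommGroup F]
    [Module ℝ F] {s : Set (E →ₗ[ℝ] F)} (hs : WeaklyBounded s) (x : E) :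
    WeaklyBounded ((fun T : E →ₗ[ℝ] F => T x) '' s) :=
  hs.image (LinearMap.applyₗ x)

variable {H : Type*} [Group H] {E : Type*} [AddCommGroup E] [Module ℝ E] [FiniteDimensional ℝ E]

/-- A bounded group of linear maps preserves a Euclidean norm: a fixed point in the hull of the
orbit of an inner product is symmetric and stays positive definite. -/
theorem exists_isometry_of_bounded (ρ : Representation ℝ H E) (hb : WeaklyBounded (Set.range ρ)) :
    ∃ R : E ≃ₗ[ℝ] EuclideanSpace ℝ (Fin (Module.finrank ℝ E)), ∀ h x, ‖R (ρ h x)‖ = ‖R x‖ := by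
  let e : E ≃ₗ[ℝ] EuclideanSpace ℝ (Fin (Module.finrank ℝ E)) :=
    (Module.finBasis ℝ E).equivFun ≪≫ₗ (WithLp.linearEquiv 2 ℝ _).symm
  let B₀ : E →ₗ[ℝ] E →ₗ[ℝ] ℝ :=
    (innerₗ (EuclideanSpace ℝ (Fin (Module.finrank ℝ E)))).compl₁₂ e.toLinearMap e.toLinearMap
  have hB₀ : ∀ x y, B₀ x y = inner ℝ (e x) (e y) := fun x y => rfl
  let σ : Representation ℝ H (E →ₗ[ℝ] E →ₗ[ℝ] ℝ) :=
    { toFun := fun h =>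
        { toFun := fun B => B.compl₁₂ (ρ h⁻¹) (ρ h⁻¹)
          map_add' := fun _ _ => rfl
          map_smul' := fun _ _ => rfl }
      map_one' := by ext B x y; simp
      map_mul' := fun a b => by
        ext B x y
        simp only [mul_inv_rev, map_mul]
        rfl }
  have hσ : ∀ h B x y, σ h B x y = B (ρ h⁻¹ x) (ρ h⁻¹ y) := fun _ _ _ _ => rfl
  have hbound : ∀ x, ∃ C : ℝ, ∀ h, ‖e (ρ h x)‖ ≤ C := by
    intro x
    obtain ⟨C, hC⟩ := ((hb.apply x).image e.toLinearMap).exists_norm_le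
    exact ⟨C, fun h => hC _ ⟨_, ⟨_, ⟨h, rfl⟩, rfl⟩, rfl⟩⟩
  obtain ⟨B, hfix, hcone⟩ := exists_fixed_of_bounded_orbit σ B₀ (by
    refine weaklyBounded_of_separating
      {φ | ∃ x y : E, φ = LinearMap.applyₗ y ∘ₗ LinearMap.applyₗ x} ?_ ?_
    · intro B hB
      ext x y
      exact hB _ ⟨x, y, rfl⟩
    · rintro _ ⟨x, y, rfl⟩
      obtain ⟨C, hC⟩ := hbound x
      obtain ⟨D, hD⟩ := hbound y
      refine ⟨C * D, ?_⟩
      rintro _ ⟨h, rfl⟩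
      change |B₀ (ρ h⁻¹ x) (ρ h⁻¹ y)| ≤ _
      rw [hB₀]
      refine (abs_real_inner_le_norm _ _).trans ?_
      exact mul_le_mul (hC _) (hD _) (norm_nonneg _) ((norm_nonneg _).trans (hC 1)))
  have hle : ∀ x y, B y x ≤ B x y := by
    intro x y
    have := hcone (LinearMap.applyₗ y ∘ₗ LinearMap.applyₗ x -
      LinearMap.applyₗ x ∘ₗ LinearMap.applyₗ y) 0 (fun h => by
        change 0 ≤ B₀ (ρ h⁻¹ x) (ρ h⁻¹ y) - B₀ (ρ h⁻¹ y) (ρ h⁻¹ x)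
        rw [hB₀, hB₀, real_inner_comm, sub_self])
    change 0 ≤ B x y - B y x at this
    linarith
  have hsymm : ∀ x y, B x y = B y x := fun x y => le_antisymm (hle y x) (hle x y)
  -- A uniform lower bound for the orbit of the form at one vector `x`.
  have hpos : ∀ x, x ≠ 0 → 0 < B x x := by
    intro x hx
    obtain ⟨C, hC⟩ := ((hb.image (LinearMap.llcomp ℝ _ _ _ e.toLinearMap)).image
      (LinearMap.lcomp ℝ _ e.symm.toLinearMap)).image
      (LinearMap.toContinuousLinearMap).toLinearMap |>.exists_norm_le
    have hC' : ∀ h y, ‖e (ρ h y)‖ ≤ C * ‖e y‖ := by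
      intro h y
      have h1 := hC _ ⟨_, ⟨_, ⟨_, ⟨h, rfl⟩, rfl⟩, rfl⟩, rfl⟩
      have h2 := ContinuousLinearMap.le_of_opNorm_le _ h1 (e y)
      simpa using h2
    have hex : 0 < ‖e x‖ := norm_pos_iff.mpr (by simpa using hx)
    have hCpos : 0 < C := by
      have := hC' 1 x
      rw [map_one, Module.End.one_apply] at this
      by_contra hcon
      nlinarith
    have := hcone (LinearMap.applyₗ x ∘ₗ LinearMap.applyₗ x) ((‖e x‖ / C) ^ 2) (fun h => by
      change _ ≤ B₀ (ρ h⁻¹ x) (ρ h⁻¹ x)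
      rw [hB₀, real_inner_self_eq_norm_sq]
      refine pow_le_pow_left₀ (by positivity) ?_ 2
      rw [div_le_iff₀ hCpos, mul_comm]
      have := hC' h (ρ h⁻¹ x)
      rwa [← Module.End.mul_apply, ← map_mul, mul_inv_cancel, map_one, Module.End.one_apply]
        at this)
    exact lt_of_lt_of_le (by positivity) this
  have hinv : ∀ h x y, B (ρ h x) (ρ h y) = B x y := by
    intro h x y
    have := LinearMap.congr_fun (LinearMap.congr_fun (hfix h⁻¹) x) y
    rwa [hσ, inv_inv] at this
  let core : InnerProductSpace.Core ℝ E :=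
    { inner := fun x y => B x y
      conj_inner_symm := fun x y => by simpa using hsymm y x
      re_inner_nonneg := fun x => by
        rcases eq_or_ne x 0 with rfl | hx
        · simp
        · simpa using (hpos x hx).le
      add_left := fun x y z => by simp
      smul_left := fun x y r => by simp
      definite := fun x hx => by
        by_contra hne
        exact (hpos x hne).ne' hx }
  let _ : NormedAddCommGroup E := core.toNormedAddCommGroup
  let _ : InnerProductSpace ℝ E := InnerProductSpace.ofCore core.toCore
  refine ⟨(stdOrthonormalBasis ℝ E).repr.toLinearEquiv, fun h x => ?_⟩
  change ‖(stdOrthonormalBasis ℝ E).repr (ρ h x)‖ = ‖(stdOrthonormalBasis ℝ E).repr x‖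
  rw [LinearIsometryEquiv.norm_map, LinearIsometryEquiv.norm_map]
  have h1 : ‖ρ h x‖ ^ 2 = ‖x‖ ^ 2 := by
    rw [← real_inner_self_eq_norm_sq, ← real_inner_self_eq_norm_sq]
    exact hinv h x x
  exact (pow_left_inj₀ (norm_nonneg _) (norm_nonneg _) two_ne_zero).mp h1

/-- In a representation, a group element is elliptic if the cyclic group that it generates acts
by a bounded set of linear maps. -/
def IsElliptic (ρ : Representation ℝ H E) (h : H) : Prop :=
  WeaklyBounded (Set.range fun m : ℤ => ρ (h ^ m))

theorem IsElliptic.exists_isometry {ρ : Representation ℝ H E} {h : H} (hh : IsElliptic ρ h) :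
    ∃ R : E ≃ₗ[ℝ] EuclideanSpace ℝ (Fin (Module.finrank ℝ E)), ∀ x, ‖R (ρ h x)‖ = ‖R x‖ := by
  obtain ⟨R, hR⟩ := exists_isometry_of_bounded (ρ.comp (Subgroup.zpowers h).subtype) (by
    refine WeaklyBounded.mono hh ?_
    rintro _ ⟨⟨_, m, rfl⟩, rfl⟩
    exact ⟨m, rfl⟩)
  exact ⟨R, hR ⟨h, Subgroup.mem_zpowers h⟩⟩

theorem trace_conj_isometry {d : ℕ} {E : Type*} [AddCommGroup E] [Module ℝ E] {T : E →ₗ[ℝ] E}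
    {R : E ≃ₗ[ℝ] EuclideanSpace ℝ (Fin d)} (hR : ∀ x, ‖R (T x)‖ = ‖R x‖) :
    ∃ c : Fin d → ℝ, LinearMap.trace ℝ E T = ∑ i, c i ∧ (∀ i, |c i| ≤ 1) ∧
      ((∀ i, c i = 1) → T = 1) := by
  let b := EuclideanSpace.basisFun (Fin d) ℝ
  have hnorm : ∀ i, ‖R (T (R.symm (b i)))‖ = 1 := fun i => by
    rw [hR, R.apply_symm_apply, b.orthonormal.1]
  refine ⟨fun i => inner ℝ (b i) (R (T (R.symm (b i)))), ?_, fun i => ?_, fun h => ?_⟩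
  · rw [← LinearMap.trace_conj' T R, LinearMap.trace_eq_sum_inner _ b]
    rfl
  · refine (abs_real_inner_le_norm _ _).trans ?_
    rw [hnorm, b.orthonormal.1, one_mul]
  · have h1 : ∀ i, R (T (R.symm (b i))) = b i := fun i =>
      ((inner_eq_one_iff_of_norm_eq_one (b.orthonormal.1 i) (hnorm i)).mp (h i)).symm
    have h2 : R.conj T = LinearMap.id := b.toBasis.ext fun i => by
      simpa [LinearEquiv.conj_apply] using h1 i
    have : R.conj T = R.conj LinearMap.id := by rw [h2, LinearEquiv.conj_id]
    exact R.conj.injective this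

theorem IsElliptic.abs_trace_le {ρ : Representation ℝ H E} {h : H} (hh : IsElliptic ρ h) :
    |LinearMap.trace ℝ E (ρ h)| ≤ Module.finrank ℝ E := by
  obtain ⟨R, hR⟩ := hh.exists_isometry
  obtain ⟨c, hc, hc1, -⟩ := trace_conj_isometry hR
  rw [hc]
  refine (Finset.abs_sum_le_sum_abs _ _).trans ((Finset.sum_le_sum fun i _ => hc1 i).trans ?_)
  simp

/-- An orthogonal matrix whose trace equals its size has all diagonal entries equal to one. -/
theorem IsElliptic.eq_one_of_trace {ρ : Representation ℝ H E} {h : H} (hh : IsElliptic ρ h)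
    (ht : LinearMap.trace ℝ E (ρ h) = Module.finrank ℝ E) : ρ h = 1 := by
  obtain ⟨R, hR⟩ := hh.exists_isometry
  obtain ⟨c, hc, hc1, h1⟩ := trace_conj_isometry hR
  refine h1 ?_
  have hsum : ∑ i, c i = ∑ _i : Fin (Module.finrank ℝ E), (1 : ℝ) := by rw [← hc, ht]; simp
  intro i
  exact (Finset.sum_eq_sum_iff_of_le fun i _ => (abs_le.mp (hc1 i)).2).mp hsum i
    (Finset.mem_univ i)

theorem WeaklyBounded.subrepresentation {ι : Type*} {ρ : Representation ℝ H E} {g : ι → H}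
    (hg : WeaklyBounded (Set.range fun i => ρ (g i))) (W : Submodule ℝ E)
    (hW : ∀ h, W ≤ W.comap (ρ h)) :
    WeaklyBounded (Set.range fun i => ρ.subrepresentation W hW (g i)) := by
  refine weaklyBounded_end fun x => WeaklyBounded.of_map_injective W.subtype_injective ?_
  refine (hg.apply (x : E)).mono ?_
  rintro _ ⟨_, ⟨_, ⟨m, rfl⟩, rfl⟩, rfl⟩
  exact ⟨_, ⟨m, rfl⟩, rfl⟩

theorem IsElliptic.subrepresentation {ρ : Representation ℝ H E} {h : H} (hh : IsElliptic ρ h)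
    (W : Submodule ℝ E) (hW : ∀ g, W ≤ W.comap (ρ g)) :
    IsElliptic (ρ.subrepresentation W hW) h :=
  WeaklyBounded.subrepresentation hh W hW

theorem IsElliptic.quotient {ρ : Representation ℝ H E} {h : H} (hh : IsElliptic ρ h)
    (W : Submodule ℝ E) (hW : ∀ g, W ≤ W.comap (ρ g)) :
    IsElliptic (ρ.quotient W hW) h := by
  refine weaklyBounded_end fun x => ?_
  obtain ⟨x, rfl⟩ := W.mkQ_surjective x
  refine ((hh.apply x).image W.mkQ).mono ?_
  rintro _ ⟨_, ⟨m, rfl⟩, rfl⟩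
  exact ⟨_, ⟨_, ⟨m, rfl⟩, rfl⟩, rfl⟩

end BoundedRepresentation

/-! ### The trace form of a completely reducible representation -/

section TraceForm

variable {E : Type*} [AddCommGroup E] [Module ℝ E] [FiniteDimensional ℝ E]

/-- Some polynomial without constant term in `c` is the projection onto the generalized eigenspace
of `c` for the eigenvalue `1`, and its trace is the dimension of that space. -/
theorem eq_zero_of_trace_pow_eq_zero {c : Module.End ℝ E}
    (hc : ∀ k, LinearMap.trace ℝ E (c ^ (k + 1)) = 0) {u : E} (hu : c u = u) : u = 0 := by
  classical
  have hm : minpoly ℝ c ≠ 0 := minpoly.ne_zero (Algebra.IsIntegral.isIntegral c)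
  obtain ⟨r, hr, hdvd⟩ := Polynomial.exists_eq_pow_rootMultiplicity_mul_and_not_dvd _ hm (1 : ℝ)
  set k := (minpoly ℝ c).rootMultiplicity 1
  have hirr : Irreducible (Polynomial.X - Polynomial.C (1 : ℝ)) := Polynomial.irreducible_X_sub_C 1
  have hndvd : ¬ (Polynomial.X - Polynomial.C (1 : ℝ)) ∣ Polynomial.X * r := by
    intro h
    rcases hirr.prime.dvd_or_dvd h with h | h
    · rw [Polynomial.dvd_iff_isRoot] at h
      simp at h
    · exact hdvd h
  have hcop : IsCoprime ((Polynomial.X - Polynomial.C (1 : ℝ)) ^ (k + 1)) (Polynomial.X * r) :=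
    ((hirr.coprime_iff_not_dvd).mpr hndvd).pow_left
  obtain ⟨α, β, hαβ⟩ := hcop
  have hzero : Polynomial.aeval c ((Polynomial.X - Polynomial.C (1 : ℝ)) ^ k * r) = 0 := by
    rw [← hr]; exact minpoly.aeval ℝ c
  set e : Module.End ℝ E := Polynomial.aeval c (β * (Polynomial.X * r)) with he
  have h1 : Polynomial.aeval c (α * (Polynomial.X - Polynomial.C (1 : ℝ)) ^ (k + 1)) + e = 1 := by
    rw [he, ← map_add, hαβ, map_one]
  have hidem : e * e = e := by
    have h2 : e * Polynomial.aeval c (α * (Polynomial.X - Polynomial.C (1 : ℝ)) ^ (k + 1)) = 0 := by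
      rw [he, ← map_mul]
      have : β * (Polynomial.X * r) * (α * (Polynomial.X - Polynomial.C (1 : ℝ)) ^ (k + 1)) =
          (β * Polynomial.X * α * (Polynomial.X - Polynomial.C 1)) *
            ((Polynomial.X - Polynomial.C (1 : ℝ)) ^ k * r) := by ring
      rw [this, map_mul, hzero, mul_zero]
    calc e * e = e * (Polynomial.aeval c
          (α * (Polynomial.X - Polynomial.C (1 : ℝ)) ^ (k + 1)) + e) := by rw [mul_add, h2, zero_add]
      _ = e := by rw [h1, mul_one]
  have htr : ∀ q : Polynomial ℝ, LinearMap.trace ℝ E (Polynomial.aeval c (q * Polynomial.X)) = 0 := by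
    intro q
    induction q using Polynomial.induction_on' with
    | add p q hp hq => rw [add_mul, map_add, map_add, hp, hq, add_zero]
    | monomial n a =>
      have : Polynomial.monomial n a * Polynomial.X = Polynomial.monomial (n + 1) a := by
        rw [Polynomial.monomial_mul_X]
      rw [this, Polynomial.aeval_monomial, ← Algebra.smul_def, map_smul, hc, smul_zero]
  have hetr : LinearMap.trace ℝ E e = 0 := by
    rw [he, show β * (Polynomial.X * r) = β * r * Polynomial.X by ring]
    exact htr _
  have hrank : Module.finrank ℝ (LinearMap.range e) = 0 := by
    have h3 := (LinearMap.IsIdempotentElem.isProj_range e hidem).trace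
    rw [hetr] at h3
    exact_mod_cast h3.symm
  have he0 : e = 0 := by
    rw [← LinearMap.range_eq_bot]
    exact Submodule.finrank_eq_zero.mp hrank
  have h4 := LinearMap.congr_fun h1 u
  rw [he0, add_zero, pow_succ, ← mul_assoc, map_mul, Module.End.mul_apply] at h4
  simpa [hu] using h4.symm

variable {H : Type*} [Group H]

/-- A completely reducible representation with bounded traces is bounded. The trace form of the
algebra spanned by the group has bounded values on the group, and it is nondegenerate:
an element `c` of its radical with `c u = u` has `u = 0`, while a minimal invariant subspace on
which the radical does not vanish would contain such a vector `u ≠ 0`. -/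
theorem weaklyBounded_range_of_trace_bounded (ρ : Representation ℝ H E)
    (hss : ∀ W : Submodule ℝ E, (∀ h, W ≤ W.comap (ρ h)) →
      ∃ W' : Submodule ℝ E, (∀ h, W' ≤ W'.comap (ρ h)) ∧ IsCompl W W')
    {C : ℝ} (htr : ∀ h, |LinearMap.trace ℝ E (ρ h)| ≤ C) : WeaklyBounded (Set.range ρ) := by
  let A : Subalgebra ℝ (Module.End ℝ E) := Algebra.adjoin ℝ (Set.range ρ)
  have hρA : ∀ h, ρ h ∈ A := fun h => Algebra.subset_adjoin ⟨h, rfl⟩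
  have hspan : ∀ a ∈ A, a ∈ Submodule.span ℝ (Set.range ρ) := by
    intro a ha
    have h1 : a ∈ Subalgebra.toSubmodule A := ha
    rw [Algebra.adjoin_eq_span] at h1
    have h2 : (Submonoid.closure (Set.range ρ) : Set (Module.End ℝ E)) = Set.range ρ := by
      have := Submonoid.closure_eq (MonoidHom.mrange ρ)
      rw [MonoidHom.coe_mrange] at this
      rw [this, MonoidHom.coe_mrange]
    rwa [h2] at h1
  have hAinv : ∀ a ∈ A, ∀ W : Submodule ℝ E, (∀ h, W ≤ W.comap (ρ h)) → ∀ x ∈ W, a x ∈ W := by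
    intro a ha W hW x hx
    replace ha := hspan a ha
    induction ha using Submodule.span_induction with
    | mem y hy => obtain ⟨h, rfl⟩ := hy; exact hW h hx
    | zero => simp
    | add y z _ _ hy hz => exact W.add_mem hy hz
    | smul r y _ hy => exact W.smul_mem r hy
  let I : Submodule ℝ (Module.End ℝ E) :=
    { carrier := {b | b ∈ A ∧ ∀ a ∈ A, LinearMap.trace ℝ E (a * b) = 0}
      zero_mem' := ⟨A.zero_mem, by simp⟩
      add_mem' := fun {x y} hx hy => ⟨A.add_mem hx.1 hy.1, fun a ha => by
        rw [mul_add, map_add, hx.2 a ha, hy.2 a ha, add_zero]⟩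
      smul_mem' := fun r x hx => ⟨A.smul_mem hx.1 r, fun a ha => by
        rw [mul_smul_comm, map_smul, hx.2 a ha, smul_zero]⟩ }
  have hIl : ∀ h, ∀ b ∈ I, ρ h * b ∈ I := fun h b hb =>
    ⟨A.mul_mem (hρA h) hb.1, fun a ha => by
      rw [← mul_assoc]; exact hb.2 _ (A.mul_mem ha (hρA h))⟩
  have hI : ∀ b ∈ I, b = 0 := by
    by_contra! hcon
    obtain ⟨b, hbI, hb0⟩ := hcon
    let P : Submodule ℝ E → Prop := fun U =>
      (∀ h, U ≤ U.comap (ρ h)) ∧ ∃ c ∈ I, ∃ u ∈ U, c u ≠ 0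
    have hP : P ⊤ := by
      refine ⟨fun h => le_top, b, hbI, ?_⟩
      by_contra! h
      exact hb0 (LinearMap.ext fun x => h x trivial)
    obtain ⟨U, ⟨hUinv, c, hcI, u, huU, hcu⟩, hUmin⟩ := exists_minimal_of_wellFoundedLT P ⟨⊤, hP⟩
    have hkill : ∀ W ≤ U, (∀ h, W ≤ W.comap (ρ h)) → W ≠ U → ∀ d ∈ I, ∀ w ∈ W, d w = 0 := by
      intro W hWU hW hne d hd w hw
      by_contra hdw
      exact hne (le_antisymm hWU (hUmin ⟨hW, d, hd, w, hw, hdw⟩ hWU))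
    let Z : Submodule ℝ E := I.map (LinearMap.applyₗ u)
    have hZinv : ∀ h, Z ≤ Z.comap (ρ h) := by
      rintro h _ ⟨d, hd, rfl⟩
      exact ⟨ρ h * d, hIl h d hd, rfl⟩
    have hZU : Z ≤ U := by
      rintro _ ⟨d, hd, rfl⟩
      exact hAinv d hd.1 U hUinv u huU
    have hcuZ : c u ∈ Z := ⟨c, hcI, rfl⟩
    by_cases hZ : Z = U
    · obtain ⟨d, hd, hdu⟩ : u ∈ Z := hZ ▸ huU
      have hu0 := eq_zero_of_trace_pow_eq_zero (c := d) (fun k => by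
        rw [pow_succ]
        exact hd.2 _ (A.pow_mem hd.1 k)) hdu
      exact hcu (by rw [hu0, map_zero])
    · obtain ⟨Z', hZ'inv, hcompl⟩ := hss Z hZinv
      have hne : U ⊓ Z' ≠ U := by
        intro h
        have h1 : c u ∈ Z' := (inf_eq_left.mp h) (hZU hcuZ)
        have h2 : c u ∈ Z ⊓ Z' := ⟨hcuZ, h1⟩
        rw [hcompl.inf_eq_bot] at h2
        exact hcu ((Submodule.mem_bot ℝ).mp h2)
      obtain ⟨z, hz, z', hz', hsum⟩ := Submodule.mem_sup.mp
        (hcompl.sup_eq_top ▸ Submodule.mem_top : u ∈ Z ⊔ Z')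
      have hz'U : z' ∈ U := by
        have : z' = u - z := by rw [← hsum]; abel
        rw [this]
        exact U.sub_mem huU (hZU hz)
      have h1 := hkill Z hZU hZinv hZ c hcI z hz
      have h2 := hkill (U ⊓ Z') inf_le_left (fun h x hx => ⟨hUinv h hx.1, hZ'inv h hx.2⟩) hne
        c hcI z' ⟨hz'U, hz'⟩
      exact hcu (by rw [← hsum, map_add, h1, h2, add_zero])
  have hbd : ∀ a ∈ A, ∃ D : ℝ, ∀ h, |LinearMap.trace ℝ E (a * ρ h)| ≤ D := by
    intro a ha
    replace ha := hspan a ha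
    induction ha using Submodule.span_induction with
    | mem y hy =>
      obtain ⟨g, rfl⟩ := hy
      exact ⟨C, fun h => by rw [← map_mul]; exact htr _⟩
    | zero => exact ⟨0, by simp⟩
    | add y z _ _ hy hz =>
      obtain ⟨D, hD⟩ := hy
      obtain ⟨D', hD'⟩ := hz
      refine ⟨D + D', fun h => ?_⟩
      rw [add_mul, map_add]
      exact (abs_add_le _ _).trans (add_le_add (hD h) (hD' h))
    | smul r y _ hy =>
      obtain ⟨D, hD⟩ := hy
      refine ⟨|r| * D, fun h => ?_⟩
      rw [smul_mul_assoc, map_smul, smul_eq_mul, abs_mul]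
      exact mul_le_mul_of_nonneg_left (hD h) (abs_nonneg r)
  have hA : WeaklyBounded (Set.range fun h => (⟨ρ h, hρA h⟩ : Subalgebra.toSubmodule A)) := by
    refine weaklyBounded_of_separating {φ | ∃ a ∈ A, φ = LinearMap.trace ℝ E ∘ₗ
      LinearMap.mulLeft ℝ a ∘ₗ (Subalgebra.toSubmodule A).subtype} ?_ ?_
    · rintro ⟨x, hx⟩ h
      refine Subtype.ext (hI x ⟨hx, fun a ha => ?_⟩)
      exact h _ ⟨a, ha, rfl⟩
    · rintro _ ⟨a, ha, rfl⟩
      obtain ⟨D, hD⟩ := hbd a ha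
      refine ⟨D, ?_⟩
      rintro _ ⟨h, rfl⟩
      exact hD h
  refine (hA.image (Subalgebra.toSubmodule A).subtype).mono ?_
  rintro _ ⟨h, rfl⟩
  exact ⟨_, ⟨h, rfl⟩, rfl⟩

end TraceForm

/-! ### The isometric semisimplification -/

section Semisimplification

variable {H : Type*} [Group H]

/-- A linear group of elliptic elements has an isometric semisimplification `p`: any finitely many
group elements are simultaneously conjugate to maps as close as desired to their images under `p`.
For an invariant subspace `W` one combines such data for `W` and for the quotient by `W`, and shrinks
the off-diagonal block by rescaling `W`; an irreducible group is bounded. -/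
theorem exists_isometric_semisimplification {E : Type*} [AddCommGroup E] [Module ℝ E]
    [FiniteDimensional ℝ E] (ρ : Representation ℝ H E) (hell : ∀ h, IsElliptic ρ h) :
    ∃ (U : Type) (_ : NormedAddCommGroup U) (_ : NormedSpace ℝ U) (_ : FiniteDimensional ℝ U)
      (p : H →* (U →L[ℝ] U)), (∀ h, ‖p h‖ ≤ 1) ∧
      ∀ (F : Finset H) (ε : ℝ), 0 < ε →
        ∃ e : E ≃ₗ[ℝ] U, ∀ f ∈ F, ∀ u, ‖e (ρ f (e.symm u)) - p f u‖ ≤ ε * ‖u‖ := by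
  induction hn : Module.finrank ℝ E using Nat.strong_induction_on generalizing E with
  | _ n ih =>
  by_cases hirr : ∃ W : Submodule ℝ E, (∀ h, W ≤ W.comap (ρ h)) ∧ W ≠ ⊥ ∧ W ≠ ⊤
  · obtain ⟨W, hW, hbot, htop⟩ := hirr
    have hltW : Module.finrank ℝ W < n := hn ▸ Submodule.finrank_lt htop
    have hltQ : Module.finrank ℝ (E ⧸ W) < n := by
      have h1 := W.finrank_quotient_add_finrank
      have h2 : Module.finrank ℝ W ≠ 0 := fun h => hbot (Submodule.finrank_eq_zero.mp h)
      omega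
    obtain ⟨A, _, _, _, pA, hpA, hA⟩ := ih _ hltW (ρ.subrepresentation W hW)
      (fun h => (hell h).subrepresentation W hW) rfl
    obtain ⟨B, _, _, _, pB, hpB, hB⟩ := ih _ hltQ (ρ.quotient W hW)
      (fun h => (hell h).quotient W hW) rfl
    obtain ⟨W', hcompl⟩ := W.exists_isCompl
    let Φ : (W × (E ⧸ W)) ≃ₗ[ℝ] E :=
      (LinearEquiv.prodCongr (LinearEquiv.refl ℝ W) (W.quotientEquivOfIsCompl W' hcompl)) ≪≫ₗ
        W.prodEquivOfIsCompl W' hcompl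
    have hΦ : ∀ w q, Φ (w, q) = w + W.quotientEquivOfIsCompl W' hcompl q := fun w q => rfl
    have hΦmk : ∀ w q, W.mkQ (Φ (w, q)) = q := by
      intro w q
      rw [hΦ, map_add, Submodule.mkQ_apply, (Submodule.Quotient.mk_eq_zero W).mpr w.2, zero_add]
      exact Submodule.mk_quotientEquivOfIsCompl_apply hcompl q
    have hΦ2 : ∀ x, (Φ.symm x).2 = W.mkQ x := by
      intro x
      conv_rhs => rw [← Φ.apply_symm_apply x]
      exact (hΦmk _ _).symm
    have hΦ1 : ∀ w : W, Φ.symm w = (w, 0) := by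
      intro w
      rw [LinearEquiv.symm_apply_eq, hΦ, map_zero, Submodule.coe_zero, add_zero]
    let β : H → (E ⧸ W) →ₗ[ℝ] W := fun h =>
      LinearMap.fst ℝ _ _ ∘ₗ Φ.symm.toLinearMap ∘ₗ ρ h ∘ₗ Φ.toLinearMap ∘ₗ LinearMap.inr ℝ _ _
    have hblock : ∀ h w q, Φ.symm (ρ h (Φ (w, q))) =
        (ρ.subrepresentation W hW h w + β h q, ρ.quotient W hW h q) := by
      intro h w q
      refine Prod.ext ?_ ?_
      · have h1 : Φ (w, q) = w + Φ (0, q) := by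
          rw [hΦ, hΦ, Submodule.coe_zero, zero_add]
        have h2 : ρ h w = (ρ.subrepresentation W hW h w : W) := rfl
        rw [h1, map_add, map_add, h2, hΦ1]
        rfl
      · rw [hΦ2]
        have : ρ.quotient W hW h (W.mkQ (Φ (w, q))) = W.mkQ (ρ h (Φ (w, q))) := rfl
        rw [← this, hΦmk]
    refine ⟨A × B, inferInstance, inferInstance, inferInstance,
      { toFun := fun h => (pA h).prodMap (pB h)
        map_one' := by ext x <;> simp
        map_mul' := fun a b => by ext x <;> simp }, ?_, ?_⟩
    · intro h
      refine ContinuousLinearMap.opNorm_le_bound _ zero_le_one fun x => ?_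
      rw [one_mul]
      change max ‖pA h x.1‖ ‖pB h x.2‖ ≤ max ‖x.1‖ ‖x.2‖
      refine max_le_max ?_ ?_
      · simpa using (pA h).le_of_opNorm_le (hpA h) x.1
      · simpa using (pB h).le_of_opNorm_le (hpB h) x.2
    · intro F ε hε
      obtain ⟨eA, heA⟩ := hA F (ε / 2) (half_pos hε)
      obtain ⟨eB, heB⟩ := hB F (ε / 2) (half_pos hε)
      let γ : H → B →L[ℝ] A := fun h =>
        LinearMap.toContinuousLinearMap (eA.toLinearMap ∘ₗ β h ∘ₗ eB.symm.toLinearMap)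
      have hγ : ∀ h b, γ h b = eA (β h (eB.symm b)) := fun h b => rfl
      let M : ℝ := ∑ f ∈ F, ‖γ f‖
      have hM : ∀ f ∈ F, ‖γ f‖ ≤ M := fun f hf =>
        Finset.single_le_sum (f := fun f => ‖γ f‖) (fun _ _ => norm_nonneg _) hf
      have hM0 : 0 ≤ M := Finset.sum_nonneg fun _ _ => norm_nonneg _
      let s : ℝ := ε / 2 / (M + 1)
      have hs : 0 < s := by positivity
      have hsM : s * M ≤ ε / 2 := by
        have : s * (M + 1) = ε / 2 := div_mul_cancel₀ _ (by positivity)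
        nlinarith
      refine ⟨Φ.symm ≪≫ₗ LinearEquiv.prodCongr
        (eA ≪≫ₗ LinearEquiv.smulOfNeZero ℝ A s hs.ne') eB, fun f hf u => ?_⟩
      obtain ⟨a, b⟩ := u
      set e := Φ.symm ≪≫ₗ LinearEquiv.prodCongr
        (eA ≪≫ₗ LinearEquiv.smulOfNeZero ℝ A s hs.ne') eB
      have he1 : ∀ x, e x = (s • eA (Φ.symm x).1, eB (Φ.symm x).2) := fun x => rfl
      have he2 : e.symm (a, b) = Φ (s⁻¹ • eA.symm a, eB.symm b) := by
        rw [LinearEquiv.symm_apply_eq, he1, Φ.symm_apply_apply]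
        simp [smul_smul, hs.ne']
      rw [he2, he1, hblock]
      have h1 : s • eA (ρ.subrepresentation W hW f (s⁻¹ • eA.symm a) + β f (eB.symm b)) =
          eA (ρ.subrepresentation W hW f (eA.symm a)) + s • γ f b := by
        rw [hγ, map_smul, map_add, smul_add, map_smul, smul_smul, mul_inv_cancel₀ hs.ne', one_smul]
      simp only [h1]
      change max ‖eA (ρ.subrepresentation W hW f (eA.symm a)) + s • γ f b - pA f a‖
        ‖eB (ρ.quotient W hW f (eB.symm b)) - pB f b‖ ≤ ε * max ‖a‖ ‖b‖
      have ha := heA f hf a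
      have hb := heB f hf b
      have hma := le_max_left ‖a‖ ‖b‖
      have hmb := le_max_right ‖a‖ ‖b‖
      refine max_le ?_ ?_
      · have h2 : ‖s • γ f b‖ ≤ ε / 2 * ‖b‖ := by
          rw [norm_smul, Real.norm_of_nonneg hs.le]
          calc s * ‖γ f b‖ ≤ s * (M * ‖b‖) :=
                mul_le_mul_of_nonneg_left ((γ f).le_of_opNorm_le (hM f hf) b) hs.le
            _ = s * M * ‖b‖ := by ring
            _ ≤ ε / 2 * ‖b‖ := mul_le_mul_of_nonneg_right hsM (norm_nonneg _)
        rw [add_sub_right_comm]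
        refine (norm_add_le _ _).trans ?_
        nlinarith
      · have := norm_nonneg b
        nlinarith
  · push Not at hirr
    have hss : ∀ W : Submodule ℝ E, (∀ h, W ≤ W.comap (ρ h)) →
        ∃ W' : Submodule ℝ E, (∀ h, W' ≤ W'.comap (ρ h)) ∧ IsCompl W W' := by
      intro W hW
      by_cases hbot : W = ⊥
      · exact ⟨⊤, fun _ => le_top, hbot ▸ isCompl_bot_top⟩
      · exact ⟨⊥, fun _ => bot_le, hirr W hW hbot ▸ isCompl_top_bot⟩
    obtain ⟨R, hR⟩ := exists_isometry_of_bounded ρ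
      (weaklyBounded_range_of_trace_bounded ρ hss fun h => (hell h).abs_trace_le)
    refine ⟨EuclideanSpace ℝ (Fin (Module.finrank ℝ E)), inferInstance, inferInstance,
      inferInstance,
      { toFun := fun h =>
          LinearMap.toContinuousLinearMap (R.toLinearMap ∘ₗ ρ h ∘ₗ R.symm.toLinearMap)
        map_one' := by ext1 x; simp
        map_mul' := fun a b => by ext1 x; simp }, fun h => ?_, fun F ε hε => ⟨R, fun f _ u => ?_⟩⟩
    · refine ContinuousLinearMap.opNorm_le_bound _ zero_le_one fun x => ?_
      change ‖R (ρ h (R.symm x))‖ ≤ 1 * ‖x‖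
      rw [hR, R.apply_symm_apply, one_mul]
    · change ‖R (ρ f (R.symm u)) - R (ρ f (R.symm u))‖ ≤ _
      rw [sub_self, norm_zero]
      positivity

end Semisimplification

/-! ### Invariant vectors -/

section InvariantVector

open scoped commutatorElement

variable {H : Type*} [Group H] {X : Type*} [AddCommGroup X] [Module ℝ X] [FiniteDimensional ℝ X]

/-- Let `s` be elliptic with bounded conjugacy class. The hull of the conjugacy class contains an
operator `P` that commutes with the group. On the generalized eigenspace `Y` of `P` for the
eigenvalue `1` the trace of `s` is that of `P`, namely `dim Y`, so that `s` is the identity on `Y`.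
An invariant functional `ℓ` satisfies `ℓ ∘ P = ℓ`, hence vanishes on the complement of `Y`. -/
theorem exists_subrepresentation_fixed_by (ρ : Representation ℝ H X) {s : H}
    (hell : IsElliptic ρ s) (hs : WeaklyBounded (Set.range fun h => ρ (h * s * h⁻¹)))
    {ℓ : Module.Dual ℝ X} (hℓ : ∀ h x, ℓ (ρ h x) = ℓ x) (hℓ0 : ℓ ≠ 0) :
    ∃ Y : Submodule ℝ X, (∀ h, Y ≤ Y.comap (ρ h)) ∧ (∀ y ∈ Y, ρ s y = y) ∧ ∃ y ∈ Y, ℓ y ≠ 0 := by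
  have hconj : ∀ h, Representation.linHom ρ ρ h (ρ s) = ρ (h * s * h⁻¹) := fun h => by
    rw [Representation.linHom_apply, map_mul, map_mul]; rfl
  obtain ⟨P, hPfix, hP⟩ := exists_fixed_of_bounded_orbit (Representation.linHom ρ ρ) (ρ s)
    (by simpa only [hconj] using hs)
  have hPconst : ∀ (φ : Module.Dual ℝ (X →ₗ[ℝ] X)) (c : ℝ),
      (∀ h, φ (ρ (h * s * h⁻¹)) = c) → φ P = c := by
    intro φ c hφ
    refine le_antisymm ?_ (hP φ c fun h => by rw [hconj, hφ])
    have := hP (-φ) (-c) fun h => by rw [hconj, LinearMap.neg_apply, hφ]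
    simpa using this
  have hρinv : ∀ h x, ρ h⁻¹ (ρ h x) = x := fun h x => by
    rw [← Module.End.mul_apply, ← map_mul, inv_mul_cancel, map_one, Module.End.one_apply]
  have hcomm : ∀ h, Commute (ρ h) P := by
    intro h
    ext x
    have := LinearMap.congr_fun (hPfix h) (ρ h x)
    rw [Representation.linHom_apply] at this
    simpa [hρinv] using this
  have hℓP : ∀ x, ℓ (P x) = ℓ x := fun x =>
    hPconst (ℓ ∘ₗ LinearMap.applyₗ x) (ℓ x) fun h => hℓ _ x
  set f : Module.End ℝ X := P - 1 with hf
  obtain ⟨k, hk, hk1⟩ := ((LinearMap.eventually_isCompl_ker_pow_range_pow f).and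
    (Filter.eventually_ge_atTop 1)).exists
  set Y := LinearMap.ker (f ^ k)
  set Z := LinearMap.range (f ^ k)
  have hfcomm : ∀ T : Module.End ℝ X, Commute T P → Commute T (f ^ k) := fun T hT =>
    (hT.sub_right (Commute.one_right T)).pow_right k
  have hYinv : ∀ T : Module.End ℝ X, Commute T P → ∀ y ∈ Y, T y ∈ Y := by
    intro T hT y hy
    have := LinearMap.congr_fun (hfcomm T hT) y
    rw [Module.End.mul_apply, Module.End.mul_apply, LinearMap.mem_ker.mp hy, map_zero] at this
    exact LinearMap.mem_ker.mpr this.symm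
  have hZinv : ∀ T : Module.End ℝ X, Commute T P → ∀ z ∈ Z, T z ∈ Z := by
    rintro T hT _ ⟨x, rfl⟩
    exact ⟨T x, (LinearMap.congr_fun (hfcomm T hT) x).symm⟩
  let π : Module.End ℝ X := Y.projection Z hk
  have hπY : ∀ y ∈ Y, π y = y := fun y hy => (Submodule.projection_apply_of_mem_left hk hy)
  have hπZ : ∀ z ∈ Z, π z = 0 := fun z hz => (Submodule.projection_apply_eq_zero_iff hk).mpr hz
  have hπcomm : ∀ T : Module.End ℝ X, Commute T P → Commute T π := by
    intro T hT
    ext x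
    obtain ⟨y, hy, z, hz, rfl⟩ := Submodule.mem_sup.mp
      (hk.sup_eq_top ▸ Submodule.mem_top : x ∈ Y ⊔ Z)
    simp only [Module.End.mul_apply, map_add, hπY y hy, hπZ z hz, hπY _ (hYinv T hT y hy),
      hπZ _ (hZinv T hT z hz), map_zero]
  have hππ : π * π = π := Submodule.isIdempotentElem_projection hk
  have hπf : LinearMap.trace ℝ X (π * f) = 0 := by
    have hc : Commute π f := ((hπcomm P (Commute.refl P)).symm).sub_right (Commute.one_right π)
    have hnil : IsNilpotent (π * f) := by
      refine ⟨k, ?_⟩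
      rw [hc.mul_pow]
      obtain ⟨j, rfl⟩ := Nat.exists_eq_add_of_le' hk1
      rw [show π ^ (j + 1) = π from IsIdempotentElem.pow_succ_eq j hππ]
      ext x
      exact hπZ _ ⟨x, rfl⟩
    exact (LinearMap.isNilpotent_trace_of_isNilpotent hnil).eq_zero
  have htr : LinearMap.trace ℝ X (π * ρ s) = LinearMap.trace ℝ X π := by
    have h1 := hPconst (LinearMap.trace ℝ X ∘ₗ LinearMap.mulLeft ℝ π)
      (LinearMap.trace ℝ X (π * ρ s)) fun h => by
        change LinearMap.trace ℝ X (π * ρ (h * s * h⁻¹)) = _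
        rw [map_mul ρ, ← mul_assoc, LinearMap.trace_mul_comm, ← mul_assoc,
          (hπcomm _ (hcomm h⁻¹)).eq, mul_assoc π, ← map_mul ρ, inv_mul_cancel_left]
    change LinearMap.trace ℝ X (π * P) = _ at h1
    rw [← h1]
    rw [hf, mul_sub, mul_one, map_sub, sub_eq_zero] at hπf
    exact hπf
  -- The representation on `Y`, extended by the identity on `Z`.
  let ρ' : Representation ℝ H X :=
    { toFun := fun h => π * ρ h + (1 - π)
      map_one' := by rw [map_one, mul_one, add_sub_cancel]
      map_mul' := fun a b => by
        have h1 : π * ρ a * (π * ρ b) = π * ρ (a * b) := by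
          rw [mul_assoc, ← mul_assoc (ρ a), (hπcomm _ (hcomm a)).eq, map_mul, mul_assoc π,
            ← mul_assoc π π, hππ]
        have h2 : π * ρ a * (1 - π) = 0 := by
          rw [mul_assoc, mul_sub, mul_one, (hπcomm _ (hcomm a)).eq, mul_sub, ← mul_assoc, hππ,
            sub_self]
        have h3 : (1 - π) * (π * ρ b) = 0 := by
          rw [← mul_assoc, sub_mul, one_mul, hππ, sub_self, zero_mul]
        have h4 : (1 - π) * (1 - π) = 1 - π := (IsIdempotentElem.one_sub hππ)
        rw [add_mul, mul_add, mul_add, h1, h2, h3, h4, add_zero, zero_add] }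
  have hell' : IsElliptic ρ' s := by
    intro φ
    obtain ⟨C, hC⟩ := hell (φ ∘ₗ LinearMap.mulLeft ℝ π)
    refine ⟨C + |φ (1 - π)|, ?_⟩
    rintro _ ⟨m, rfl⟩
    change |φ (π * ρ (s ^ m) + (1 - π))| ≤ _
    rw [map_add]
    exact (abs_add_le _ _).trans (add_le_add (hC _ ⟨m, rfl⟩) le_rfl)
  have hone : ρ' s = 1 := by
    refine hell'.eq_one_of_trace ?_
    change LinearMap.trace ℝ X (π * ρ s + (1 - π)) = _
    rw [map_add, htr, map_sub, add_sub_cancel, LinearMap.trace_one]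
  refine ⟨Y, fun h y hy => hYinv _ (hcomm h) y hy, fun y hy => ?_, ?_⟩
  · have h1 := LinearMap.congr_fun hone y
    change π (ρ s y) + (y - π y) = y at h1
    rwa [hπY y hy, sub_self, add_zero, hπY _ (hYinv _ (hcomm s) y hy)] at h1
  · obtain ⟨x, hx⟩ : ∃ x, ℓ x ≠ 0 := by
      by_contra! h
      exact hℓ0 (LinearMap.ext h)
    obtain ⟨y, hy, z, hz, rfl⟩ := Submodule.mem_sup.mp
      (hk.sup_eq_top ▸ Submodule.mem_top : x ∈ Y ⊔ Z)
    refine ⟨y, hy, ?_⟩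
    obtain ⟨w, rfl⟩ := hz
    obtain ⟨j, rfl⟩ := Nat.exists_eq_add_of_le' hk1
    have : ℓ ((f ^ (j + 1)) w) = 0 := by
      rw [pow_succ', Module.End.mul_apply, hf, LinearMap.sub_apply, Module.End.one_apply, map_sub,
        hℓP, sub_self]
    rwa [map_add, this, add_zero] at hx

/-- The iterated commutators `⁅f₁, ⁅f₂, … ⁅fₙ, f⁆ … ⁆⁆` of elements of `F`. -/
def iteratedCommutators (F : Set H) : ℕ → Set H
  | 0 => F
  | n + 1 => {x | ∃ f ∈ F, ∃ y ∈ iteratedCommutators F n, x = ⁅f, y⁆}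

/-- A group of elliptic elements that is nilpotent modulo elements with bounded conjugacy class,
in the sense of the hypotheses, has a fixed vector on each invariant affine hyperplane `ℓ = 1`.
Passing to the subspaces of `exists_subrepresentation_fixed_by`, one may assume that every element
with bounded conjugacy class acts trivially. Then so do the `m`-fold iterated commutators; the
`(m - 1)`-fold ones act by central operators, so they act trivially, and so on down to `F`. -/
theorem exists_invariant_vector (ρ : Representation ℝ H X) (hell : ∀ h, IsElliptic ρ h)
    {F B : Set H} (hgen : Subgroup.closure (F ∪ B) = ⊤)
    (hB : ∀ b ∈ B, WeaklyBounded (Set.range fun h => ρ (h * b * h⁻¹)))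
    {m : ℕ} (hF : iteratedCommutators F m ⊆ B)
    {ℓ : Module.Dual ℝ X} (hℓ : ∀ h x, ℓ (ρ h x) = ℓ x) (hℓ0 : ℓ ≠ 0) :
    ∃ x, (∀ h, ρ h x = x) ∧ ℓ x = 1 := by
  induction hn : Module.finrank ℝ X using Nat.strong_induction_on generalizing X with
  | _ n ih =>
  by_cases htriv : ∀ s, WeaklyBounded (Set.range fun h => ρ (h * s * h⁻¹)) → ρ s = 1
  · have hBtriv : ∀ b ∈ B, ρ b = 1 := fun b hb => htriv b (hB b hb)
    have hstep : ∀ k, (∀ x ∈ iteratedCommutators F (k + 1), ρ x = 1) →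
        ∀ x ∈ iteratedCommutators F k, ρ x = 1 := by
      intro k hk x hx
      refine htriv x ?_
      have hcent : ∀ h : H, Commute (ρ h) (ρ x) := by
        intro h
        have hmem : h ∈ Subgroup.closure (F ∪ B) := hgen ▸ Subgroup.mem_top h
        induction hmem using Subgroup.closure_induction with
        | mem g hg =>
          rcases hg with hg | hg
          · have h1 := hk ⁅g, x⁆ ⟨g, hg, x, hx, rfl⟩
            have h2 : ρ (g * x) = ρ ⁅g, x⁆ * ρ (x * g) := by
              rw [← map_mul]
              congr 1
              rw [commutatorElement_def]
              group
            rw [h1, one_mul, map_mul, map_mul] at h2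
            exact h2
          · rw [hBtriv g hg]
            exact Commute.one_left _
        | one => rw [map_one]; exact Commute.one_left _
        | mul a b _ _ ha hb => rw [map_mul]; exact ha.mul_left hb
        | inv a _ ha =>
          have h1 : ρ a⁻¹ * ρ a = 1 := by rw [← map_mul, inv_mul_cancel, map_one]
          have h2 : ρ a * ρ a⁻¹ = 1 := by rw [← map_mul, mul_inv_cancel, map_one]
          calc ρ a⁻¹ * ρ x = ρ a⁻¹ * (ρ x * ρ a) * ρ a⁻¹ := by
                rw [mul_assoc, mul_assoc, h2, mul_one]
            _ = ρ x * ρ a⁻¹ := by rw [← ha.eq, ← mul_assoc, h1, one_mul]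
      have hconst : (Set.range fun h => ρ (h * x * h⁻¹)) ⊆ {ρ x} := by
        rintro _ ⟨h, rfl⟩
        simp only [Set.mem_singleton_iff]
        rw [map_mul, map_mul, (hcent h).eq, mul_assoc, ← map_mul, mul_inv_cancel, map_one, mul_one]
      refine WeaklyBounded.mono (fun φ => ⟨|φ (ρ x)|, ?_⟩) hconst
      rintro _ rfl
      exact le_rfl
    have hFtriv : ∀ x ∈ iteratedCommutators F 0, ρ x = 1 := by
      have : ∀ j ≤ m, ∀ x ∈ iteratedCommutators F (m - j), ρ x = 1 := by
        intro j
        induction j with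
        | zero => exact fun _ x hx => hBtriv x (hF hx)
        | succ j ihj =>
          intro hj
          refine hstep _ ?_
          rw [show m - (j + 1) + 1 = m - j by omega]
          exact ihj (by omega)
      simpa using this m le_rfl
    have hall : ∀ h, ρ h = 1 := by
      have hle : Subgroup.closure (F ∪ B) ≤ MonoidHom.ker (MonoidHom.toHomUnits ρ) := by
        rw [Subgroup.closure_le]
        rintro g (hg | hg)
        · exact Units.ext (hFtriv g hg)
        · exact Units.ext (hBtriv g hg)
      rw [hgen] at hle
      intro h
      exact congrArg Units.val (hle (Subgroup.mem_top h) : MonoidHom.toHomUnits ρ h = 1)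
    obtain ⟨x, hx⟩ : ∃ x, ℓ x ≠ 0 := by
      by_contra! h
      exact hℓ0 (LinearMap.ext h)
    refine ⟨(ℓ x)⁻¹ • x, fun h => by rw [hall h, Module.End.one_apply], ?_⟩
    rw [map_smul, smul_eq_mul, inv_mul_cancel₀ hx]
  · push Not at htriv
    obtain ⟨s, hs, hs1⟩ := htriv
    obtain ⟨Y, hY, hYs, y, hyY, hy⟩ := exists_subrepresentation_fixed_by ρ (hell s) hs hℓ hℓ0
    have hYtop : Y ≠ ⊤ := by
      rintro rfl
      exact hs1 (LinearMap.ext fun x => hYs x trivial)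
    obtain ⟨x, hx, hx1⟩ := ih _ (hn ▸ Submodule.finrank_lt hYtop) (ρ.subrepresentation Y hY)
      (fun h => (hell h).subrepresentation Y hY)
      (fun b hb => (hB b hb).subrepresentation Y hY) (ℓ := ℓ ∘ₗ Y.subtype)
      (fun h x => hℓ h x) (fun h => hy (LinearMap.congr_fun h ⟨y, hyY⟩)) rfl
    exact ⟨x, fun h => congrArg Subtype.val (hx h), hx1⟩

end InvariantVector

/-! ### Closed groups near the identity -/

section ClosedGroup

open scoped commutatorElement

open Filter Topology

variable {G : Type*} [Group G] {V : Type*} [NormedAddCommGroup V] [NormedSpace ℝ V]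
  {U : Type*} [NormedAddCommGroup U] [NormedSpace ℝ U]

/-- The algebraic representation underlying a homomorphism to continuous linear maps. -/
def toRepresentation (ρ : G →* (V →L[ℝ] V)) : Representation ℝ G V :=
  (ContinuousLinearMap.toLinearMapRingHom : (V →L[ℝ] V) →+* (V →ₗ[ℝ] V)).toMonoidHom.comp ρ

theorem weaklyBounded_toRepresentation_iff [FiniteDimensional ℝ V] {ι : Type*}
    {ρ : G →* (V →L[ℝ] V)} {g : ι → G} :
    WeaklyBounded (Set.range fun i => toRepresentation ρ (g i)) ↔ ∃ C, ∀ i, ‖ρ (g i)‖ ≤ C := by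
  constructor
  · intro h
    obtain ⟨C, hC⟩ := (h.image
      (LinearMap.toContinuousLinearMap (𝕜 := ℝ) (E := V) (F' := V)).toLinearMap).exists_norm_le
    exact ⟨C, fun i => hC _ ⟨_, ⟨i, rfl⟩, rfl⟩⟩
  · rintro ⟨C, hC⟩
    refine weaklyBounded_end fun x => weaklyBounded_of_norm (C := C * ‖x‖) ?_
    rintro _ ⟨_, ⟨i, rfl⟩, rfl⟩
    exact (ρ (g i)).le_of_opNorm_le (hC i) x

/-- The trace of a continuous linear map. -/
noncomputable def continuousTrace (V : Type*) [NormedAddCommGroup V] [NormedSpace ℝ V]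
    [FiniteDimensional ℝ V] : (V →L[ℝ] V) →L[ℝ] ℝ :=
  LinearMap.toContinuousLinearMap (LinearMap.trace ℝ V ∘ₗ ContinuousLinearMap.coeLM ℝ)

theorem continuousTrace_apply [FiniteDimensional ℝ V] (T : V →L[ℝ] V) :
    continuousTrace V T = LinearMap.trace ℝ V (T : V →ₗ[ℝ] V) := rfl

/-- The conjugate of a homomorphism to linear maps of `V` by an isomorphism of `V` with `U`. -/
noncomputable def conjHom [FiniteDimensional ℝ U] (ρ : G →* (V →L[ℝ] V)) (e : V ≃ₗ[ℝ] U) :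
    G →* (U →L[ℝ] U) where
  toFun g := LinearMap.toContinuousLinearMap (e.toLinearMap ∘ₗ (ρ g).toLinearMap ∘ₗ
    e.symm.toLinearMap)
  map_one' := by ext1 x; simp
  map_mul' a b := by ext1 x; simp

theorem conjHom_apply [FiniteDimensional ℝ U] (ρ : G →* (V →L[ℝ] V)) (e : V ≃ₗ[ℝ] U) (g : G)
    (u : U) : conjHom ρ e g u = e (ρ g (e.symm u)) := rfl

/-- `p` is an isometric semisimplification of `ρ`: it is contractive, and on each finite set of
group elements it is a limit of conjugates of `ρ`. -/
structure IsIsometricSemisimplification [FiniteDimensional ℝ U]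
    (ρ : G →* (V →L[ℝ] V)) (p : G →* (U →L[ℝ] U)) : Prop where
  norm_le_one : ∀ g, ‖p g‖ ≤ 1
  exists_near : ∀ (F : Finset G) (ε : ℝ), 0 < ε →
    ∃ e : V ≃ₗ[ℝ] U, ∀ f ∈ F, ‖conjHom ρ e f - p f‖ ≤ ε

variable [FiniteDimensional ℝ V] [FiniteDimensional ℝ U]

theorem IsIsometricSemisimplification.trace_eq {ρ : G →* (V →L[ℝ] V)} {p : G →* (U →L[ℝ] U)}
    (hp : IsIsometricSemisimplification ρ p) (g : G) :
    continuousTrace U (p g) = continuousTrace V (ρ g) := by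
  have hK := norm_nonneg (continuousTrace U)
  set K := ‖continuousTrace U‖
  have h : ∀ ε : ℝ, 0 < ε → |continuousTrace V (ρ g) - continuousTrace U (p g)| ≤ K * ε := by
    intro ε hε
    obtain ⟨e, he⟩ := hp.exists_near {g} ε hε
    have h1 : continuousTrace U (conjHom ρ e g) = continuousTrace V (ρ g) :=
      LinearMap.trace_conj' _ e
    rw [← h1, ← map_sub]
    exact ((continuousTrace U).le_opNorm _).trans
      (mul_le_mul_of_nonneg_left (he g (Finset.mem_singleton_self g)) hK)
  have h0 : |continuousTrace V (ρ g) - continuousTrace U (p g)| ≤ 0 := by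
    refine le_of_forall_pos_le_add fun ε hε => (h (ε / (K + 1)) (by positivity)).trans ?_
    rw [zero_add, mul_div_assoc', div_le_iff₀ (by positivity)]
    nlinarith
  have := abs_nonpos_iff.mp h0
  linarith

theorem norm_pow_sub_one_sub_le {A : Type*} [NormedRing A] {g : A} {d : ℝ}
    (hd : ‖g - 1‖ ≤ d) (m : ℕ) (hm : m * d ≤ 1) :
    ‖g ^ m - 1 - (m : A) * (g - 1)‖ ≤ (m * d) ^ 2 := by
  have hd0 : 0 ≤ d := (norm_nonneg _).trans hd
  induction m with
  | zero => simp
  | succ m ih =>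
    push_cast at hm ⊢
    have hm' : m * d ≤ 1 := by nlinarith
    have h1 : g ^ (m + 1) - 1 - ((m : A) + 1) * (g - 1) =
        (g ^ m - 1 - (m : A) * (g - 1)) + ((g ^ m - 1 - (m : A) * (g - 1)) * (g - 1) +
          (m : A) * ((g - 1) * (g - 1))) := by
      rw [pow_succ]
      noncomm_ring
    have h2 : ‖(m : A) * ((g - 1) * (g - 1))‖ ≤ m * (d * d) := by
      rw [← nsmul_eq_mul]
      refine (norm_nsmul_le).trans ?_
      refine mul_le_mul_of_nonneg_left ((norm_mul_le _ _).trans ?_) (Nat.cast_nonneg m)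
      exact mul_le_mul hd hd (norm_nonneg _) hd0
    have h3 : ‖(g ^ m - 1 - (m : A) * (g - 1)) * (g - 1)‖ ≤ (m * d) ^ 2 * d :=
      (norm_mul_le _ _).trans (mul_le_mul (ih hm') hd (norm_nonneg _) (sq_nonneg _))
    rw [h1]
    refine (norm_add_le _ _).trans ((add_le_add (ih hm')
      ((norm_add_le _ _).trans (add_le_add h3 h2))).trans ?_)
    have hm0 : (0 : ℝ) ≤ m := Nat.cast_nonneg m
    have h4 : (m * d) ^ 2 * d ≤ m * d * d := by
      rw [sq]
      have : m * d * (m * d) ≤ m * d * 1 := mul_le_mul_of_nonneg_left hm' (by positivity)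
      nlinarith
    nlinarith [mul_nonneg hd0 hd0, mul_nonneg hm0 (mul_nonneg hd0 hd0)]

theorem norm_pow_sub_one_le_of_norm_le_one {A : Type*} [NormedRing A] {g : A} (hg : ‖g‖ ≤ 1)
    (m : ℕ) : ‖g ^ m - 1‖ ≤ m * ‖g - 1‖ := by
  induction m with
  | zero => simp
  | succ m ih =>
    have h1 : g ^ (m + 1) - 1 = g * (g ^ m - 1) + (g - 1) := by rw [pow_succ']; noncomm_ring
    rw [h1]
    push_cast
    have h2 : ‖g * (g ^ m - 1)‖ ≤ 1 * ‖g ^ m - 1‖ :=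
      (norm_mul_le _ _).trans (mul_le_mul_of_nonneg_right hg (norm_nonneg _))
    refine (norm_add_le _ _).trans ?_
    linarith

/-- On a closed group of elliptic elements the semisimplification is an immersion at the identity.
Otherwise, powers of elements near the identity accumulate at some `h ≠ 1` of the group with
`p h = 1`; the trace of `h` is the dimension, so that `h = 1`. -/
theorem IsIsometricSemisimplification.exists_norm_sub_one_le {ρ : G →* (V →L[ℝ] V)}
    {p : G →* (U →L[ℝ] U)} (hp : IsIsometricSemisimplification ρ p)
    (hcl : IsClosed (Set.range ρ)) (hell : ∀ g, IsElliptic (toRepresentation ρ) g) :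
    ∃ δ > 0, ∃ C, ∀ g, ‖ρ g - 1‖ ≤ δ → ‖ρ g - 1‖ ≤ C * ‖p g - 1‖ := by
  by_contra! hcon
  have hex : ∀ k : ℕ, ∃ g, ‖ρ g - 1‖ ≤ 1 / 4 ∧ ((k : ℝ) + 1) * ‖p g - 1‖ < ‖ρ g - 1‖ :=
    fun k => hcon (1 / 4) (by norm_num) (k + 1)
  choose g hg1 hg2 using hex
  have hd : ∀ k, 0 < ‖ρ (g k) - 1‖ := fun k =>
    lt_of_le_of_lt (mul_nonneg (by positivity) (norm_nonneg _)) (hg2 k)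
  let m : ℕ → ℕ := fun k => ⌊1 / (2 * ‖ρ (g k) - 1‖)⌋₊
  have hm1 : ∀ k, (m k : ℝ) * ‖ρ (g k) - 1‖ ≤ 1 / 2 := by
    intro k
    have h1 : (m k : ℝ) ≤ 1 / (2 * ‖ρ (g k) - 1‖) := Nat.floor_le (by positivity)
    have h2 := mul_le_mul_of_nonneg_right h1 (hd k).le
    have h3 : 1 / (2 * ‖ρ (g k) - 1‖) * ‖ρ (g k) - 1‖ = 1 / 2 := by
      have := (hd k).ne'
      field_simp
    linarith
  have hm2 : ∀ k, 1 / 4 ≤ (m k : ℝ) * ‖ρ (g k) - 1‖ := by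
    intro k
    have h1 : 1 / (2 * ‖ρ (g k) - 1‖) < m k + 1 := Nat.lt_floor_add_one _
    have h2 := mul_le_mul_of_nonneg_right h1.le (hd k).le
    have h3 : 1 / (2 * ‖ρ (g k) - 1‖) * ‖ρ (g k) - 1‖ = 1 / 2 := by
      have := (hd k).ne'
      field_simp
    have := hg1 k
    linarith
  have hmul : ∀ k, ‖(m k : V →L[ℝ] V) * (ρ (g k) - 1)‖ = m k * ‖ρ (g k) - 1‖ := by
    intro k
    rw [← nsmul_eq_mul, ← Nat.cast_smul_eq_nsmul ℝ, norm_smul, Real.norm_natCast]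
  have hlow : ∀ k, 1 / 8 ≤ ‖ρ (g k ^ m k) - 1‖ := by
    intro k
    have h1 := norm_pow_sub_one_sub_le (le_refl ‖ρ (g k) - 1‖) (m k) ((hm1 k).trans (by norm_num))
    have h2 := norm_sub_norm_le ((m k : V →L[ℝ] V) * (ρ (g k) - 1)) (ρ (g k) ^ m k - 1)
    rw [norm_sub_rev ((m k : V →L[ℝ] V) * _), hmul] at h2
    rw [map_pow]
    have := hm1 k
    have := hm2 k
    nlinarith
  have hup : ∀ k, ‖ρ (g k ^ m k) - 1‖ ≤ 3 / 4 := by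
    intro k
    have h1 := norm_pow_sub_one_sub_le (le_refl ‖ρ (g k) - 1‖) (m k) ((hm1 k).trans (by norm_num))
    have h2 := norm_sub_norm_le (ρ (g k) ^ m k - 1) ((m k : V →L[ℝ] V) * (ρ (g k) - 1))
    rw [hmul] at h2
    rw [map_pow]
    have := hm1 k
    have := hm2 k
    nlinarith
  have := FiniteDimensional.proper ℝ (V →L[ℝ] V)
  obtain ⟨T, -, φ, hφ, hT⟩ := (isCompact_closedBall (1 : V →L[ℝ] V) (3 / 4)).tendsto_subseq
    (x := fun k => ρ (g k ^ m k)) (fun k => by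
      rw [Metric.mem_closedBall, dist_eq_norm]
      exact hup k)
  obtain ⟨h, rfl⟩ := hcl.mem_of_tendsto hT (Eventually.of_forall fun k => ⟨_, rfl⟩)
  have hne : 1 / 8 ≤ ‖ρ h - 1‖ :=
    ge_of_tendsto (hT.sub_const 1).norm (Eventually.of_forall fun k => hlow _)
  have hplim : Tendsto (fun k => p (g (φ k) ^ m (φ k))) atTop (𝓝 1) := by
    rw [tendsto_iff_norm_sub_tendsto_zero]
    have hb : ∀ k : ℕ, ‖p (g k ^ m k) - 1‖ ≤ 1 / ((k : ℝ) + 1) := by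
      intro k
      rw [map_pow]
      refine (norm_pow_sub_one_le_of_norm_le_one (hp.norm_le_one _) _).trans ?_
      rw [le_div_iff₀ (by positivity)]
      have h1 := hg2 k
      have h2 := hm1 k
      have h3 : (0 : ℝ) ≤ m k := Nat.cast_nonneg _
      nlinarith
    exact squeeze_zero (fun _ => norm_nonneg _) (fun k => hb (φ k))
      (tendsto_one_div_add_atTop_nhds_zero_nat.comp hφ.tendsto_atTop)
  have htr : continuousTrace V (ρ h) = continuousTrace U (p 1) := by
    refine tendsto_nhds_unique (((continuousTrace V).continuous.tendsto _).comp hT) ?_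
    rw [map_one]
    refine (((continuousTrace U).continuous.tendsto _).comp hplim).congr fun k => ?_
    exact hp.trace_eq _
  rw [hp.trace_eq, map_one, continuousTrace_apply, continuousTrace_apply] at htr
  have hone : toRepresentation ρ h = 1 := by
    refine (hell h).eq_one_of_trace ?_
    rw [← LinearMap.trace_one (R := ℝ)]
    exact htr
  have hρ : ρ h = 1 := ContinuousLinearMap.coe_injective hone
  rw [hρ, sub_self, norm_zero] at hne
  norm_num at hne

theorem norm_map_inv_le_two {A : Type*} [NormedRing A] (h1 : ‖(1 : A)‖ ≤ 1) (q : G →* A) {g : G}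
    (hg : ‖q g - 1‖ ≤ 1 / 2) : ‖q g⁻¹‖ ≤ 2 := by
  have h2 : q g⁻¹ = 1 - q g⁻¹ * (q g - 1) := by
    rw [mul_sub, ← map_mul, inv_mul_cancel, map_one, mul_one]; abel
  have h3 : ‖q g⁻¹‖ ≤ 1 + ‖q g⁻¹‖ * (1 / 2) := by
    conv_lhs => rw [h2]
    refine (norm_sub_le _ _).trans (add_le_add h1 ((norm_mul_le _ _).trans ?_))
    exact mul_le_mul_of_nonneg_left hg (norm_nonneg _)
  linarith

theorem norm_map_commutator_sub_one_le {A : Type*} [NormedRing A] (h1 : ‖(1 : A)‖ ≤ 1)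
    (q : G →* A) {f x : G} (hf : ‖q f - 1‖ ≤ 1 / 16) (hx : ‖q x - 1‖ ≤ 1 / 16) :
    ‖q ⁅f, x⁆ - 1‖ ≤ ‖q x - 1‖ / 2 := by
  have hinv : ∀ g, q g * q g⁻¹ = 1 := fun g => by rw [← map_mul, mul_inv_cancel, map_one]
  have h2 : q ⁅f, x⁆ - 1 =
      ((q f - 1) * (q x - 1) - (q x - 1) * (q f - 1)) * q f⁻¹ * q x⁻¹ := by
    have h3 : q x * q f * q f⁻¹ * q x⁻¹ = 1 := by rw [mul_assoc (q x), hinv, mul_one, hinv]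
    have h4 : (q f - 1) * (q x - 1) - (q x - 1) * (q f - 1) = q f * q x - q x * q f := by
      noncomm_ring
    rw [h4, sub_mul, sub_mul, h3, commutatorElement_def, map_mul, map_mul, map_mul]
  have h5 := norm_map_inv_le_two h1 q (hf.trans (by norm_num))
  have h6 := norm_map_inv_le_two h1 q (hx.trans (by norm_num))
  have h7 : ‖(q f - 1) * (q x - 1) - (q x - 1) * (q f - 1)‖ ≤ ‖q x - 1‖ / 8 := by
    refine (norm_sub_le _ _).trans ((add_le_add (norm_mul_le _ _) (norm_mul_le _ _)).trans ?_)
    have := norm_nonneg (q x - 1)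
    nlinarith
  rw [h2]
  calc _ ≤ ‖q x - 1‖ / 8 * 2 * 2 := by
        refine (norm_mul_le _ _).trans (mul_le_mul ((norm_mul_le _ _).trans ?_) h6
          (norm_nonneg _) (by positivity))
        exact mul_le_mul h7 h5 (norm_nonneg _) (by positivity)
    _ = ‖q x - 1‖ / 2 := by ring

theorem norm_map_sub_one_le_of_mem_iteratedCommutators {A : Type*} [NormedRing A]
    (h1 : ‖(1 : A)‖ ≤ 1) (q : G →* A) {F : Set G} (hF : ∀ f ∈ F, ‖q f - 1‖ ≤ 1 / 16) (m : ℕ) :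
    ∀ x ∈ iteratedCommutators F m, ‖q x - 1‖ ≤ (1 / 2) ^ m / 16 := by
  induction m with
  | zero => simpa [iteratedCommutators] using hF
  | succ m ih =>
    rintro _ ⟨f, hf, x, hx, rfl⟩
    have h2 : ‖q x - 1‖ ≤ 1 / 16 :=
      (ih x hx).trans (div_le_div_of_nonneg_right (pow_le_one₀ (by norm_num) (by norm_num))
        (by norm_num))
    refine (norm_map_commutator_sub_one_le h1 q (hF f hf) h2).trans ?_
    rw [pow_succ]
    linarith [ih x hx]

end ClosedGroup

/-! ### Boundedness of closed groups of elliptic elements -/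

section Bounded

variable {G : Type*} [Group G]

/-- The linear maps into `W` that are scalar on `W`. Those that are the identity on `W`
are the projections onto `W`. -/
def scalarOn {V : Type*} [AddCommGroup V] [Module ℝ V] (W : Submodule ℝ V) :
    Submodule ℝ (V →ₗ[ℝ] V) where
  carrier := {T | (∀ v, T v ∈ W) ∧ ∃ c : ℝ, ∀ w ∈ W, T w = c • w}
  zero_mem' := ⟨by simp, 0, by simp⟩
  add_mem' := by
    rintro S T ⟨hS, c, hc⟩ ⟨hT, d, hd⟩
    refine ⟨fun v => W.add_mem (hS v) (hT v), c + d, fun w hw => ?_⟩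
    rw [LinearMap.add_apply, hc w hw, hd w hw, add_smul]
  smul_mem' := by
    rintro r T ⟨hT, c, hc⟩
    refine ⟨fun v => W.smul_mem r (hT v), r * c, fun w hw => ?_⟩
    rw [LinearMap.smul_apply, hc w hw, mul_smul]

section Algebraic

variable {V : Type*} [AddCommGroup V] [Module ℝ V]

/-- The action of `G` by conjugation preserves `scalarOn W` if `W` is invariant. -/
theorem scalarOn_le_comap_linHom (ρ : Representation ℝ G V) {W : Submodule ℝ V}
    (hW : ∀ g, W ≤ W.comap (ρ g)) (g : G) :
    scalarOn W ≤ (scalarOn W).comap (Representation.linHom ρ ρ g) := by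
  rintro T ⟨hT, c, hc⟩
  refine ⟨fun v => hW g (hT _), c, fun w hw => ?_⟩
  rw [Representation.linHom_apply, LinearMap.comp_apply, LinearMap.comp_apply, hc _ (hW g⁻¹ hw),
    map_smul, ← Module.End.mul_apply, ← map_mul, mul_inv_cancel, map_one, Module.End.one_apply]

theorem exists_mem_scalarOn_trace_ne_zero [FiniteDimensional ℝ V] {W : Submodule ℝ V} (hW : W ≠ ⊥) :
    ∃ T ∈ scalarOn W, LinearMap.trace ℝ V T ≠ 0 := by
  obtain ⟨W', h⟩ := W.exists_isCompl
  refine ⟨W.projection W' h, ⟨Submodule.projection_apply_mem h, 1, fun w hw => ?_⟩, ?_⟩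
  · rw [one_smul, Submodule.projection_apply_of_mem_left h hw]
  · have h1 : LinearMap.IsProj W (W.projection W' h) :=
      ⟨Submodule.projection_apply_mem h, fun w hw => Submodule.projection_apply_of_mem_left h hw⟩
    rw [h1.trace]
    exact_mod_cast fun h0 => hW (Submodule.finrank_eq_zero.mp h0)

theorem isCompl_ker_of_mem_scalarOn {W : Submodule ℝ V} {T : V →ₗ[ℝ] V} (hT : T ∈ scalarOn W)
    (htr : LinearMap.trace ℝ V T ≠ 0) : IsCompl W (LinearMap.ker T) := by
  obtain ⟨hTW, c, hc⟩ := hT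
  have hc0 : c ≠ 0 := by
    rintro rfl
    refine htr (LinearMap.isNilpotent_trace_of_isNilpotent ⟨2, ?_⟩).eq_zero
    ext v
    rw [sq, Module.End.mul_apply, hc _ (hTW v), zero_smul, LinearMap.zero_apply]
  refine isCompl_iff.mpr ⟨Submodule.disjoint_def.mpr fun w hw hk => ?_,
    codisjoint_iff.mpr (eq_top_iff.mpr fun v _ => ?_)⟩
  · rw [LinearMap.mem_ker, hc w hw] at hk
    exact (smul_eq_zero.mp hk).resolve_left hc0
  · refine Submodule.mem_sup.mpr ⟨c⁻¹ • T v, W.smul_mem _ (hTW v), v - c⁻¹ • T v, ?_, by abel⟩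
    rw [LinearMap.mem_ker, map_sub, map_smul, hc _ (hTW v), inv_smul_smul₀ hc0, sub_self]

end Algebraic

open scoped commutatorElement

open Filter Topology

variable {V : Type*} [NormedAddCommGroup V] [NormedSpace ℝ V] [FiniteDimensional ℝ V]
  {U : Type*} [NormedAddCommGroup U] [NormedSpace ℝ U] [FiniteDimensional ℝ U]

theorem norm_map_conj_sub_one_le {A : Type*} [NormedRing A] (q : G →* A) (h b : G) :
    ‖q (h * b * h⁻¹) - 1‖ ≤ ‖q h‖ * ‖q b - 1‖ * ‖q h⁻¹‖ := by
  have : q (h * b * h⁻¹) - 1 = q h * (q b - 1) * q h⁻¹ := by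
    rw [mul_sub, sub_mul, mul_one, ← map_mul, ← map_mul, ← map_mul, mul_inv_cancel, map_one]
  rw [this]
  exact (norm_mul_le _ _).trans (mul_le_mul_of_nonneg_right (norm_mul_le _ _) (norm_nonneg _))

theorem weaklyBounded_linHom {ρ : G →* (V →L[ℝ] V)} {ι : Type*} {g : ι → G} {C : ℝ}
    (h1 : ∀ i, ‖ρ (g i)‖ ≤ C) (h2 : ∀ i, ‖ρ (g i)⁻¹‖ ≤ C) :
    WeaklyBounded (Set.range fun i =>
      Representation.linHom (toRepresentation ρ) (toRepresentation ρ) (g i)) := by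
  refine weaklyBounded_end fun T => weaklyBounded_end fun v => weaklyBounded_of_norm
    (C := C * (‖LinearMap.toContinuousLinearMap T‖ * (C * ‖v‖))) ?_
  rintro _ ⟨_, ⟨_, ⟨i, rfl⟩, rfl⟩, rfl⟩
  have hC : 0 ≤ C := (norm_nonneg _).trans (h1 i)
  change ‖ρ (g i) (T (ρ (g i)⁻¹ v))‖ ≤ _
  refine ((ρ (g i)).le_of_opNorm_le (h1 i) _).trans (mul_le_mul_of_nonneg_left ?_ hC)
  refine ((LinearMap.toContinuousLinearMap T).le_opNorm _).trans
    (mul_le_mul_of_nonneg_left ?_ (norm_nonneg _))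
  exact (ρ (g i)⁻¹).le_of_opNorm_le (h2 i) v

theorem IsElliptic.linHom {ρ : G →* (V →L[ℝ] V)} {g : G}
    (hg : IsElliptic (toRepresentation ρ) g) :
    IsElliptic (Representation.linHom (toRepresentation ρ) (toRepresentation ρ)) g := by
  obtain ⟨C, hC⟩ := weaklyBounded_toRepresentation_iff.mp hg
  refine weaklyBounded_linHom (C := C) hC fun m => ?_
  rw [← zpow_neg]
  exact hC _

/-- Finitely many elements `F` of a closed group of elliptic elements, with images under the
semisimplification near the identity, commute with a projection onto an invariant subspace `W`,
up to a scalar factor.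
This is the existence of an invariant vector for the group generated by `F` and a neighborhood `B`
of the identity. As the semisimplification is an immersion, a small `B` cut out by the
semisimplification is normalized by `F`; and iterated commutators of elements of `F` converge to the
identity, hence lie in `B`. -/
theorem IsIsometricSemisimplification.exists_commute_finset {ρ : G →* (V →L[ℝ] V)}
    {p : G →* (U →L[ℝ] U)} (hp : IsIsometricSemisimplification ρ p)
    (hcl : IsClosed (Set.range ρ)) (hell : ∀ g, IsElliptic (toRepresentation ρ) g)
    {W : Submodule ℝ V} (hW0 : W ≠ ⊥)
    (hW : ∀ g, ‖p g - 1‖ ≤ 1 / 32 → W ≤ W.comap (toRepresentation ρ g))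
    (F : Finset G) (hF : ∀ f ∈ F, ‖p f - 1‖ ≤ 1 / 32) :
    ∃ T ∈ scalarOn W, (∀ f ∈ F, Commute (toRepresentation ρ f) T) ∧
      LinearMap.trace ℝ V T = 1 := by
  obtain ⟨δ₀, hδ₀, C₀, hC₀⟩ := hp.exists_norm_sub_one_le hcl hell
  set δ := min δ₀ (1 / 2)
  have hδpos : 0 < δ := lt_min hδ₀ (by norm_num)
  have hδ2 : δ ≤ 1 / 2 := min_le_right _ _
  set C := max C₀ 1
  have hCpos : 0 < C := lt_of_lt_of_le one_pos (le_max_right _ _)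
  have hC : ∀ g, ‖ρ g - 1‖ ≤ δ → ‖ρ g - 1‖ ≤ C * ‖p g - 1‖ := fun g hg =>
    (hC₀ g (hg.trans (min_le_left _ _))).trans
      (mul_le_mul_of_nonneg_right (le_max_left _ _) (norm_nonneg _))
  set M : ℝ := 3 + ∑ f ∈ F, ‖ρ f‖ * ‖ρ f⁻¹‖
  have hMsum : 0 ≤ ∑ f ∈ F, ‖ρ f‖ * ‖ρ f⁻¹‖ :=
    Finset.sum_nonneg fun _ _ => mul_nonneg (norm_nonneg _) (norm_nonneg _)
  set η := min (δ / (C * M)) (1 / 32)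
  have hMpos : 0 < M := by linarith
  have hηpos : 0 < η := lt_min (by positivity) (by norm_num)
  have hηC : M * (C * η) ≤ δ := by
    have : η ≤ δ / (C * M) := min_le_left _ _
    rw [le_div_iff₀ (by positivity)] at this
    linarith
  let B : Set G := {g | ‖ρ g - 1‖ ≤ δ ∧ ‖p g - 1‖ ≤ η}
  have h1V : ‖(1 : V →L[ℝ] V)‖ ≤ 1 := ContinuousLinearMap.norm_id_le
  have h1U : ‖(1 : U →L[ℝ] U)‖ ≤ 1 := ContinuousLinearMap.norm_id_le
  have hBinv : ∀ b ∈ B, ‖ρ b‖ ≤ 2 ∧ ‖ρ b⁻¹‖ ≤ 2 := by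
    rintro b ⟨hb, -⟩
    refine ⟨?_, norm_map_inv_le_two h1V ρ (hb.trans hδ2)⟩
    have := norm_add_le (ρ b - 1) 1
    rw [sub_add_cancel] at this
    linarith
  have hconj : ∀ h, ‖ρ h‖ * ‖ρ h⁻¹‖ ≤ M → ∀ b ∈ B, h * b * h⁻¹ ∈ B := by
    rintro h hh b ⟨hb1, hb2⟩
    constructor
    · have h2 : ‖ρ b - 1‖ ≤ C * η :=
        (hC b hb1).trans (mul_le_mul_of_nonneg_left hb2 hCpos.le)
      calc _ ≤ ‖ρ h‖ * ‖ρ b - 1‖ * ‖ρ h⁻¹‖ := norm_map_conj_sub_one_le ρ h b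
        _ = ‖ρ h‖ * ‖ρ h⁻¹‖ * ‖ρ b - 1‖ := by ring
        _ ≤ M * (C * η) := mul_le_mul hh h2 (norm_nonneg _) hMpos.le
        _ ≤ δ := hηC
    · have h3 := hp.norm_le_one h
      have h4 := hp.norm_le_one h⁻¹
      have h5 := norm_nonneg (p b - 1)
      calc _ ≤ ‖p h‖ * ‖p b - 1‖ * ‖p h⁻¹‖ := norm_map_conj_sub_one_le p h b
        _ ≤ 1 * ‖p b - 1‖ * 1 := by gcongr
        _ ≤ η := by linarith
  have hgenM : ∀ h ∈ (F : Set G) ∪ B, ‖ρ h‖ * ‖ρ h⁻¹‖ ≤ M := by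
    rintro h (hh | hh)
    · have := Finset.single_le_sum (f := fun f => ‖ρ f‖ * ‖ρ f⁻¹‖)
        (fun _ _ => mul_nonneg (norm_nonneg _) (norm_nonneg _)) hh
      linarith
    · have hb : ‖ρ h‖ ≤ 3 / 2 := by
        have := norm_add_le (ρ h - 1) 1
        rw [sub_add_cancel] at this
        linarith [hh.1]
      have := (hBinv h hh).2
      have := norm_nonneg (ρ h⁻¹)
      have := norm_nonneg (ρ h)
      nlinarith
  have hnormal : ∀ h ∈ Subgroup.closure ((F : Set G) ∪ B),
      (∀ b ∈ B, h * b * h⁻¹ ∈ B) ∧ ∀ b ∈ B, h⁻¹ * b * h ∈ B := by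
    intro h hh
    induction hh using Subgroup.closure_induction with
    | mem h hh =>
      refine ⟨hconj h (hgenM h hh), ?_⟩
      have := hconj h⁻¹ (by rw [inv_inv, mul_comm]; exact hgenM h hh)
      rwa [inv_inv] at this
    | one => simp
    | mul x y _ _ hx hy =>
      refine ⟨fun b hb => ?_, fun b hb => ?_⟩
      · have := hx.1 _ (hy.1 b hb)
        rwa [show x * y * b * (x * y)⁻¹ = x * (y * b * y⁻¹) * x⁻¹ by group]
      · have := hy.2 _ (hx.2 b hb)
        rwa [show (x * y)⁻¹ * b * (x * y) = y⁻¹ * (x⁻¹ * b * x) * y by group]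
    | inv x _ hx => exact ⟨by simpa using hx.2, by simpa using hx.1⟩
  -- The iterated commutators contract in coordinates in which `F` is near the identity.
  obtain ⟨e, he⟩ := hp.exists_near F (1 / 32) (by norm_num)
  have hFe : ∀ f ∈ (F : Set G), ‖conjHom ρ e f - 1‖ ≤ 1 / 16 := by
    intro f hf
    have := norm_sub_le_norm_sub_add_norm_sub (conjHom ρ e f) (p f) 1
    linarith [he f hf, hF f hf]
  obtain ⟨K, hK0, hK⟩ : ∃ K : ℝ, 0 ≤ K ∧ ∀ g, ‖ρ g - 1‖ ≤ K * ‖conjHom ρ e g - 1‖ := by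
    let a : V →L[ℝ] U := LinearMap.toContinuousLinearMap e.toLinearMap
    let b : U →L[ℝ] V := LinearMap.toContinuousLinearMap e.symm.toLinearMap
    refine ⟨‖b‖ * ‖a‖, by positivity, fun g => ?_⟩
    have h2 : ρ g - 1 = b ∘L (conjHom ρ e g - 1) ∘L a := by
      ext x
      simp [a, b, conjHom_apply]
    rw [h2]
    refine (ContinuousLinearMap.opNorm_comp_le _ _).trans ?_
    rw [mul_assoc]
    refine mul_le_mul_of_nonneg_left ?_ (norm_nonneg _)
    rw [mul_comm]
    exact ContinuousLinearMap.opNorm_comp_le _ _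
  obtain ⟨m, hm⟩ : ∃ m, iteratedCommutators (F : Set G) m ⊆ B := by
    obtain ⟨m, hm⟩ := exists_pow_lt_of_lt_one
      (show 0 < min (δ / (K + 1)) η from lt_min (by positivity) hηpos)
      (by norm_num : (1 / 2 : ℝ) < 1)
    refine ⟨m, fun x hx => ?_⟩
    have h2 := norm_map_sub_one_le_of_mem_iteratedCommutators h1U (conjHom ρ e) hFe m x hx
    have h3 := norm_map_sub_one_le_of_mem_iteratedCommutators h1U p
      (fun f hf => (hF f hf).trans (by norm_num)) m x hx
    have h4 : (0 : ℝ) < (1 / 2) ^ m := by positivity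
    have h5 := hm.trans_le (min_le_left _ _)
    have h6 := hm.trans_le (min_le_right _ _)
    rw [lt_div_iff₀ (by positivity)] at h5
    refine ⟨(hK x).trans ?_, by linarith⟩
    nlinarith
  let H : Subgroup G := Subgroup.closure ((F : Set G) ∪ B)
  have hWH : ∀ h : H, W ≤ W.comap (toRepresentation ρ h) := by
    have hinv : ∀ g, ‖p g - 1‖ ≤ 1 / 32 → ‖p g⁻¹ - 1‖ ≤ 1 / 32 := by
      intro g hg
      have h2 : p g⁻¹ - 1 = - (p g⁻¹ * (p g - 1)) := by
        rw [mul_sub, ← map_mul, inv_mul_cancel, map_one, mul_one]; abel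
      rw [h2, norm_neg]
      have := hp.norm_le_one g⁻¹
      have := norm_nonneg (p g - 1)
      refine (norm_mul_le _ _).trans ?_
      nlinarith
    have hmem : ∀ g ∈ (F : Set G) ∪ B, ‖p g - 1‖ ≤ 1 / 32 := by
      rintro g (hg | hg)
      · exact hF g hg
      · exact hg.2.trans (min_le_right _ _)
    have : ∀ h ∈ H, W ≤ W.comap (toRepresentation ρ h) ∧ W ≤ W.comap (toRepresentation ρ h⁻¹) := by
      intro h hh
      induction hh using Subgroup.closure_induction with
      | mem g hg => exact ⟨hW g (hmem g hg), hW _ (hinv g (hmem g hg))⟩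
      | one => rw [inv_one, map_one]; exact ⟨le_rfl, le_rfl⟩
      | mul x y _ _ hx hy =>
        rw [mul_inv_rev, map_mul, map_mul]
        exact ⟨fun w hw => hx.1 (hy.1 hw), fun w hw => hy.2 (hx.2 hw)⟩
      | inv x _ hx => rw [inv_inv]; exact hx.symm
    exact fun h => (this h h.2).1
  let ρH : H →* (V →L[ℝ] V) := ρ.comp H.subtype
  have hellH : ∀ h, IsElliptic (toRepresentation ρH) h := fun h => hell h
  let σ := (Representation.linHom (toRepresentation ρH) (toRepresentation ρH)).subrepresentation
    (scalarOn W) (scalarOn_le_comap_linHom (toRepresentation ρH) hWH)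
  let F' : Set H := Subtype.val ⁻¹' (F : Set G)
  let B' : Set H := Subtype.val ⁻¹' B
  have hgen : Subgroup.closure (F' ∪ B') = ⊤ := by
    have := Subgroup.closure_closure_coe_preimage (k := (F : Set G) ∪ B)
    exact this
  have hcomm : iteratedCommutators F' m ⊆ B' := by
    have : ∀ k, ∀ x ∈ iteratedCommutators F' k,
        (x : G) ∈ iteratedCommutators (F : Set G) k := by
      intro k
      induction k with
      | zero => exact fun x hx => hx
      | succ k ih =>
        rintro _ ⟨f, hf, y, hy, rfl⟩
        exact ⟨f, hf, y, ih y hy, rfl⟩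
    exact fun x hx => hm (this m x hx)
  obtain ⟨T₀, hT₀, hT₀tr⟩ := exists_mem_scalarOn_trace_ne_zero hW0
  obtain ⟨T, hTfix, hTtr⟩ := exists_invariant_vector σ
    (fun h => (hellH h).linHom.subrepresentation _ _) hgen
    (fun b hb => WeaklyBounded.subrepresentation
      (weaklyBounded_linHom (ρ := ρH) (g := fun h : H => h * b * h⁻¹) (C := 2)
        (fun h => (hBinv _ ((hnormal h h.2).1 b hb)).1)
        (fun h => (hBinv _ ((hnormal h h.2).1 b hb)).2)) _ _)
    hcomm (ℓ := LinearMap.trace ℝ V ∘ₗ (scalarOn W).subtype)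
    (fun h T => by
      change LinearMap.trace ℝ V (toRepresentation ρH h ∘ₗ (T : V →ₗ[ℝ] V) ∘ₗ
        toRepresentation ρH h⁻¹) = LinearMap.trace ℝ V (T : V →ₗ[ℝ] V)
      rw [← Module.End.mul_eq_comp, ← Module.End.mul_eq_comp, LinearMap.trace_mul_comm, mul_assoc,
        ← map_mul, inv_mul_cancel, map_one, mul_one])
    (fun h => hT₀tr (LinearMap.congr_fun h ⟨T₀, hT₀⟩))
  refine ⟨T, T.2, fun f hf => ?_, hTtr⟩
  have hfH : f ∈ H := Subgroup.subset_closure (Or.inl hf)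
  have h2 := congrArg Subtype.val (hTfix ⟨f, hfH⟩)
  ext v
  have h3 := LinearMap.congr_fun h2 (ρ f v)
  change ρ f ((T : V →ₗ[ℝ] V) (ρ f⁻¹ (ρ f v))) = (T : V →ₗ[ℝ] V) (ρ f v) at h3
  rw [← mul_apply_eq_comp, ← map_mul, inv_mul_cancel, map_one,
    one_apply_eq_self] at h3
  exact h3

/-- A closed group of elliptic elements is bounded. The subgroup `N` generated by the elements whose
images under the semisimplification are near the identity has finite index. An invariant subspace
of `N` has an invariant complement, since finitely many generators already define the smallest
possible space of invariant candidates for a projection. So `N` is completely reducible, and it is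
bounded because its traces are. -/
theorem exists_norm_le_of_isElliptic (ρ : G →* (V →L[ℝ] V)) (hcl : IsClosed (Set.range ρ))
    (hell : ∀ g, IsElliptic (toRepresentation ρ) g) : ∃ C, ∀ g, ‖ρ g‖ ≤ C := by
  obtain ⟨U, _, _, _, p, hp1, hp2⟩ :=
    exists_isometric_semisimplification (toRepresentation ρ) hell
  have hp : IsIsometricSemisimplification ρ p := ⟨hp1, fun F ε hε => by
    obtain ⟨e, he⟩ := hp2 F ε hε
    exact ⟨e, fun f hf => ContinuousLinearMap.opNorm_le_bound _ hε.le (he f hf)⟩⟩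
  let S : Set G := {g | ‖p g - 1‖ ≤ 1 / 32}
  let N : Subgroup G := Subgroup.closure S
  let ρN : N →* (V →L[ℝ] V) := ρ.comp N.subtype
  have hss : ∀ W : Submodule ℝ V, (∀ h, W ≤ W.comap (toRepresentation ρN h)) →
      ∃ W' : Submodule ℝ V, (∀ h, W' ≤ W'.comap (toRepresentation ρN h)) ∧ IsCompl W W' := by
    intro W hW
    by_cases hW0 : W = ⊥
    · exact ⟨⊤, fun _ => le_top, hW0 ▸ isCompl_bot_top⟩
    let Fix : Finset G → Submodule ℝ (V →ₗ[ℝ] V) := fun F =>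
      scalarOn W ⊓ Subalgebra.toSubmodule
        (Subalgebra.centralizer ℝ (toRepresentation ρ '' (F : Set G)))
    obtain ⟨Y, ⟨F, hFS, rfl⟩, hmin⟩ := exists_minimal_of_wellFoundedLT
      (fun Y => ∃ F : Finset G, (∀ f ∈ F, f ∈ S) ∧ Y = Fix F) ⟨_, ∅, by simp, rfl⟩
    obtain ⟨T, hTW, hTF, hTtr⟩ := hp.exists_commute_finset hcl hell hW0
      (fun g hg => hW ⟨g, Subgroup.subset_closure hg⟩) F hFS
    have hTFix : T ∈ Fix F := by
      refine ⟨hTW, Subalgebra.mem_centralizer_iff ℝ |>.mpr ?_⟩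
      rintro _ ⟨f, hf, rfl⟩
      exact hTF f hf
    have hTS : ∀ g ∈ S, Commute (toRepresentation ρ g) T := by
      classical
      intro g hg
      have hle : Fix (insert g F) ≤ Fix F :=
        inf_le_inf_left _ (Subalgebra.centralizer_le ℝ _ _ (Set.image_mono (by simp)))
      have h2 := hmin ⟨insert g F, by
        intro f hf
        rcases Finset.mem_insert.mp hf with rfl | hf
        · exact hg
        · exact hFS f hf, rfl⟩ hle hTFix
      exact (Subalgebra.mem_centralizer_iff ℝ).mp h2.2 _ ⟨g, by simp, rfl⟩
    have hTN : ∀ h ∈ N, ∀ v, T (ρ h v) = ρ h (T v) := by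
      intro h hh
      induction hh using Subgroup.closure_induction with
      | mem g hg => exact fun v => (LinearMap.congr_fun (hTS g hg) v).symm
      | one => simp
      | mul x y _ _ hx hy =>
        intro v
        rw [map_mul, mul_apply_eq_comp, mul_apply_eq_comp, hx, hy]
      | inv x _ hx =>
        intro v
        have hxi : ∀ w, ρ x⁻¹ (ρ x w) = w := fun w => by
          rw [← mul_apply_eq_comp, ← map_mul, inv_mul_cancel, map_one,
            one_apply_eq_self]
        have hxi' : ∀ w, ρ x (ρ x⁻¹ w) = w := fun w => by
          rw [← mul_apply_eq_comp, ← map_mul, mul_inv_cancel, map_one,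
            one_apply_eq_self]
        rw [← hxi (T (ρ x⁻¹ v)), ← hx, hxi']
    refine ⟨LinearMap.ker T, fun h v hv => ?_,
      isCompl_ker_of_mem_scalarOn hTW (by rw [hTtr]; exact one_ne_zero)⟩
    rw [Submodule.mem_comap, LinearMap.mem_ker]
    change T (ρ h v) = 0
    rw [hTN h h.2, LinearMap.mem_ker.mp hv, map_zero]
  obtain ⟨C, hC⟩ := weaklyBounded_toRepresentation_iff (g := id) |>.mp
    (weaklyBounded_range_of_trace_bounded (toRepresentation ρN) hss
      fun h => IsElliptic.abs_trace_le (hell h))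
  have hprop := FiniteDimensional.proper ℝ (U →L[ℝ] U)
  have htb : TotallyBounded (Set.range p) := by
    refine (isCompact_closedBall (0 : U →L[ℝ] U) 1).totallyBounded.subset ?_
    rintro _ ⟨g, rfl⟩
    rw [mem_closedBall_zero_iff]
    exact hp.norm_le_one g
  obtain ⟨t, htsub, htfin, ht⟩ := Metric.finite_approx_of_totallyBounded htb (1 / 32) (by norm_num)
  refine ⟨∑ u ∈ htfin.toFinset, ‖ρ (Function.invFun p u)‖ * C, fun g => ?_⟩
  obtain ⟨u, hu, hgu⟩ := Set.mem_iUnion₂.mp (ht ⟨g, rfl⟩)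
  obtain ⟨a, ha⟩ : ∃ a, Function.invFun p u = a := ⟨_, rfl⟩
  have hpa : p a = u := ha ▸ Function.invFun_eq (htsub hu)
  have hS : a⁻¹ * g ∈ S := by
    change ‖p (a⁻¹ * g) - 1‖ ≤ 1 / 32
    have h2 : p (a⁻¹ * g) - 1 = p a⁻¹ * (p g - p a) := by
      rw [mul_sub, ← map_mul, ← map_mul, inv_mul_cancel, map_one]
    rw [Metric.mem_ball, dist_eq_norm, ← hpa] at hgu
    rw [h2]
    have := hp.norm_le_one a⁻¹
    have := norm_nonneg (p g - p a)
    refine (norm_mul_le _ _).trans ?_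
    nlinarith
  have h3 := hC ⟨a⁻¹ * g, Subgroup.subset_closure hS⟩
  have h4 : ρ g = ρ a * ρ (a⁻¹ * g) := by rw [← map_mul, mul_inv_cancel_left]
  have hC0 : 0 ≤ C := (norm_nonneg _).trans h3
  rw [h4]
  refine (norm_mul_le _ _).trans ((mul_le_mul_of_nonneg_left h3 (norm_nonneg _)).trans ?_)
  rw [← ha]
  exact Finset.single_le_sum (f := fun u => ‖ρ (Function.invFun p u)‖ * C)
    (fun _ _ => mul_nonneg (norm_nonneg _) hC0) (htfin.mem_toFinset.mpr hu)

end Bounded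

/-! ### Distal actions on the sphere -/

section Sphere

open Filter Topology

/-- The standard representation of `SL(n + 1, ℝ)` by continuous linear maps of Euclidean space. -/
noncomputable def euclideanHom (n : ℕ) :
    SL(n + 1, ℝ) →*
      (EuclideanSpace ℝ (Fin (n + 1)) →L[ℝ] EuclideanSpace ℝ (Fin (n + 1))) :=
  ((Matrix.toEuclideanCLM (n := Fin (n + 1)) (𝕜 := ℝ)).toAlgEquiv : _ →* _).comp
    ((Units.coeHom _).comp Matrix.SpecialLinearGroup.toGL)

variable {n : ℕ}

theorem euclideanHom_apply (A : SL(n + 1, ℝ)) :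
    euclideanHom n A = Matrix.toEuclideanCLM (n := Fin (n + 1)) (𝕜 := ℝ) A.val := rfl

theorem isClosedEmbedding_euclideanHom : IsClosedEmbedding (euclideanHom n) := by
  let e := (Matrix.toEuclideanCLM (n := Fin (n + 1)) (𝕜 := ℝ)).toAlgEquiv.toLinearEquiv
  have he : IsClosedEmbedding e := by
    have := (LinearEquiv.toContinuousLinearEquiv e).toHomeomorph.isClosedEmbedding
    exact this
  exact he.comp Matrix.SpecialLinearGroup.isClosedEmbedding_val

theorem det_euclideanHom (A : SL(n + 1, ℝ)) : (euclideanHom n A).det = 1 := by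
  rw [euclideanHom_apply, ContinuousLinearMap.det, Matrix.coe_toEuclideanCLM_eq_toEuclideanLin,
    Matrix.toEuclideanLin_eq_toLin_orthonormal, LinearMap.det_toLin]
  exact A.2

theorem isCompact_setOf_norm_euclideanHom_le (C : ℝ) :
    IsCompact {A : SL(n + 1, ℝ) | ‖euclideanHom n A‖ ≤ C} := by
  have hprop := FiniteDimensional.proper ℝ
    (EuclideanSpace ℝ (Fin (n + 1)) →L[ℝ] EuclideanSpace ℝ (Fin (n + 1)))
  have := isClosedEmbedding_euclideanHom (n := n) |>.isCompact_preimage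
    (isCompact_closedBall (0 : EuclideanSpace ℝ (Fin (n + 1)) →L[ℝ] _) C)
  convert this using 1
  ext A
  simp

theorem coe_sphereMap_toGL (A : SL(n + 1, ℝ)) (x : UnitSphere n) :
    (sphereMap (Matrix.SpecialLinearGroup.toGL A) x : EuclideanSpace ℝ (Fin (n + 1))) =
      ‖euclideanHom n A x‖⁻¹ • euclideanHom n A x := rfl

theorem euclideanHom_apply_ne_zero (A : SL(n + 1, ℝ)) {x : EuclideanSpace ℝ (Fin (n + 1))}
    (hx : x ≠ 0) : euclideanHom n A x ≠ 0 :=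
  toEuclideanLin_GL_ne_zero (Matrix.SpecialLinearGroup.toGL A) hx

theorem actsDistallyOnSphere_iff (S : Subsemigroup SL(n + 1, ℝ)) :
    ActsDistallyOnSphere S ↔ ∀ x y : UnitSphere n, x ≠ y →
      Disjoint (closure ((fun A => (sphereMap (Matrix.SpecialLinearGroup.toGL A) x,
        sphereMap (Matrix.SpecialLinearGroup.toGL A) y)) '' (S : Set SL(n + 1, ℝ))))
        (Set.diagonal (UnitSphere n)) := by
  refine forall₃_congr fun x y _ => ?_
  have : {p : UnitSphere n × UnitSphere n | ∃ T ∈ S.map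
      ((sphereAction n).comp Matrix.SpecialLinearGroup.toGL).toMulHom, p = (T x, T y)} =
      (fun A => (sphereMap (Matrix.SpecialLinearGroup.toGL A) x,
        sphereMap (Matrix.SpecialLinearGroup.toGL A) y)) '' (S : Set SL(n + 1, ℝ)) := by
    ext p
    constructor
    · rintro ⟨_, ⟨A, hA, rfl⟩, rfl⟩
      exact ⟨A, hA, rfl⟩
    · rintro ⟨A, hA, rfl⟩
      exact ⟨_, ⟨A, hA, rfl⟩, rfl⟩
  rw [this]

theorem ActsDistallyOnSphere.mono {S C : Subsemigroup SL(n + 1, ℝ)} (hS : ActsDistallyOnSphere S)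
    (h : C ≤ S) : ActsDistallyOnSphere C := by
  rw [actsDistallyOnSphere_iff] at hS ⊢
  exact fun x y hxy => (hS x y hxy).mono_left (closure_mono (Set.image_mono h))

theorem continuous_sphereMap_toGL (x : UnitSphere n) :
    Continuous fun A : SL(n + 1, ℝ) => sphereMap (Matrix.SpecialLinearGroup.toGL A) x := by
  refine Continuous.subtype_mk ?_ _
  have h : Continuous fun A : SL(n + 1, ℝ) => euclideanHom n A x :=
    isClosedEmbedding_euclideanHom.continuous.clm_apply continuous_const
  exact (h.norm.inv₀ fun A => norm_ne_zero_iff.mpr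
    (euclideanHom_apply_ne_zero A x.ne_zero)).smul h

/-- The set of pairs `(A x, A y)` with `A` in a compact set is closed and consists of pairs of
distinct points. -/
theorem actsDistallyOnSphere_of_bounded {S : Subsemigroup SL(n + 1, ℝ)} {C : ℝ}
    (hC : ∀ A ∈ S, ‖euclideanHom n A‖ ≤ C) : ActsDistallyOnSphere S := by
  rw [actsDistallyOnSphere_iff]
  intro x y hxy
  have hcomp := (isCompact_setOf_norm_euclideanHom_le (n := n) C).image
    ((continuous_sphereMap_toGL x).prodMk (continuous_sphereMap_toGL y))
  refine Disjoint.mono_left (closure_minimal (Set.image_mono hC) hcomp.isClosed) ?_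
  rw [Set.disjoint_left]
  rintro _ ⟨A, -, rfl⟩ hA
  exact hxy ((sphereAction n (Matrix.SpecialLinearGroup.toGL A)).injective hA)

/-- If `S` is unbounded, normalized elements of `S` accumulate at some `B ≠ 0` with `det B = 0`.
For `B x ≠ 0` and `B y = 0` the directions of `x` and `x + y` are moved to a common limit. -/
theorem ActsDistallyOnSphere.bounded {S : Subsemigroup SL(n + 1, ℝ)}
    (hS : ActsDistallyOnSphere S) : ∃ C, ∀ A ∈ S, ‖euclideanHom n A‖ ≤ C := by
  rw [actsDistallyOnSphere_iff] at hS
  by_contra! hcon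
  choose A hAS hA using fun k : ℕ => hcon k
  have hpos : ∀ k, 0 < ‖euclideanHom n (A k)‖ := fun k => lt_of_le_of_lt (Nat.cast_nonneg k) (hA k)
  have hprop := FiniteDimensional.proper ℝ
    (EuclideanSpace ℝ (Fin (n + 1)) →L[ℝ] EuclideanSpace ℝ (Fin (n + 1)))
  let B : ℕ → EuclideanSpace ℝ (Fin (n + 1)) →L[ℝ] EuclideanSpace ℝ (Fin (n + 1)) :=
    fun k => ‖euclideanHom n (A k)‖⁻¹ • euclideanHom n (A k)
  have hB : ∀ k, ‖B k‖ = 1 := fun k => by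
    rw [norm_smul, norm_inv, norm_norm, inv_mul_cancel₀ (hpos k).ne']
  obtain ⟨L, hL, φ, hφ, hlim⟩ := (isCompact_sphere
    (0 : EuclideanSpace ℝ (Fin (n + 1)) →L[ℝ] EuclideanSpace ℝ (Fin (n + 1))) 1).tendsto_subseq
    (x := B) (fun k => by rw [mem_sphere_zero_iff_norm, hB])
  have hL1 : ‖L‖ = 1 := mem_sphere_zero_iff_norm.mp hL
  have hdet : L.det = 0 := by
    refine tendsto_nhds_unique ((ContinuousLinearMap.continuous_det.tendsto L).comp hlim) ?_
    have hdetB : ∀ k, (B k).det = (‖euclideanHom n (A k)‖⁻¹) ^ (n + 1) := by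
      intro k
      have h1 : (B k).det = _ := LinearMap.det_smul (‖euclideanHom n (A k)‖⁻¹)
        (euclideanHom n (A k) : _ →ₗ[ℝ] EuclideanSpace ℝ (Fin (n + 1)))
      have h2 : LinearMap.det
        (euclideanHom n (A k) : _ →ₗ[ℝ] EuclideanSpace ℝ (Fin (n + 1))) = 1 :=
        det_euclideanHom (A k)
      rw [h1, h2, mul_one, finrank_euclideanSpace_fin]
    have h3 : Tendsto (fun k => ‖euclideanHom n (A k)‖) atTop atTop :=
      tendsto_atTop_mono (fun k => (hA k).le) tendsto_natCast_atTop_atTop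
    have h4 := (h3.inv_tendsto_atTop.pow (n + 1)).comp hφ.tendsto_atTop
    rw [zero_pow (Nat.succ_ne_zero n)] at h4
    exact h4.congr fun k => (hdetB (φ k)).symm
  obtain ⟨y, hyL, hy0⟩ := Submodule.exists_mem_ne_zero_of_ne_bot
    (LinearMap.det_eq_zero_iff_ker_ne_bot.mp hdet)
  replace hyL : L y = 0 := hyL
  obtain ⟨x, hx⟩ : ∃ x, L x ≠ 0 := by
    by_contra! h
    rw [show L = 0 from ContinuousLinearMap.ext h, norm_zero] at hL1
    exact zero_ne_one hL1
  have hne : ∀ z, L z = L x → z ≠ 0 := by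
    rintro z hz rfl
    exact hx (by rw [← hz, map_zero])
  let dir : ∀ z : EuclideanSpace ℝ (Fin (n + 1)), z ≠ 0 → UnitSphere n := fun z hz => ⟨‖z‖⁻¹ • z, by
    rw [mem_sphere_zero_iff_norm]; exact norm_smul_inv_norm (𝕜 := ℝ) hz⟩
  have htend : ∀ z (hz : L z = L x), Tendsto
      (fun k => sphereMap (Matrix.SpecialLinearGroup.toGL (A (φ k))) (dir z (hne z hz)))
      atTop (𝓝 (dir (L x) hx)) := by
    intro z hz
    rw [tendsto_subtype_rng]
    have h1 : Tendsto (fun k => B (φ k) z) atTop (𝓝 (L x)) :=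
      hz ▸ ((ContinuousLinearMap.apply ℝ _ z).continuous.tendsto L).comp hlim
    have h2 := (h1.norm.inv₀ (norm_ne_zero_iff.mpr hx)).smul h1
    refine h2.congr fun k => ?_
    have hz0 : ‖z‖ ≠ 0 := norm_ne_zero_iff.mpr (hne z hz)
    have hAz : ‖euclideanHom n (A (φ k)) z‖ ≠ 0 :=
      norm_ne_zero_iff.mpr (euclideanHom_apply_ne_zero _ (hne z hz))
    have hAk := (hpos (φ k)).ne'
    rw [coe_sphereMap_toGL]
    simp only [B, dir, smul_apply, map_smul, norm_smul, norm_inv, norm_norm,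
      smul_smul, mul_inv, inv_inv]
    congr 1
    field_simp
  have hxy : L (x + y) = L x := by rw [map_add, hyL, add_zero]
  have hdir : dir x (hne x rfl) ≠ dir (x + y) (hne _ hxy) := by
    intro h
    have h1 : ‖x‖⁻¹ • x = ‖x + y‖⁻¹ • (x + y) := congrArg Subtype.val h
    have h2 : ‖x‖⁻¹ • L x = ‖x + y‖⁻¹ • L x := by
      rw [← map_smul, h1, map_smul, hxy]
    have h3 : ‖x‖⁻¹ = ‖x + y‖⁻¹ := smul_left_injective ℝ hx h2
    rw [← h3] at h1
    have h4 := smul_right_injective _ (inv_ne_zero (norm_ne_zero_iff.mpr (hne x rfl))) h1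
    exact hy0 (by simpa using h4.symm)
  have hdiag : (dir (L x) hx, dir (L x) hx) ∈ Set.diagonal (UnitSphere n) := rfl
  refine Set.disjoint_left.mp (hS _ _ hdir) ?_ hdiag
  refine mem_closure_of_tendsto ((htend x rfl).prodMk_nhds (htend _ hxy))
    (Eventually.of_forall fun k => ?_)
  exact ⟨A (φ k), hAS (φ k), rfl⟩

/-- Powers of `T` accumulate, so quotients of powers of `T` converge to the identity, and
`T⁻¹` is a limit of positive powers of `T`. -/
theorem inv_mem_of_bounded_powers {S : Subsemigroup SL(n + 1, ℝ)}
    (hS : IsClosed (S : Set SL(n + 1, ℝ))) {T : SL(n + 1, ℝ)} (hT : T ∈ S) {C : ℝ}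
    (hC : ∀ k : ℕ, ‖euclideanHom n (T ^ (k + 1))‖ ≤ C) : T⁻¹ ∈ S := by
  have : FirstCountableTopology SL(n + 1, ℝ) :=
    isClosedEmbedding_euclideanHom.isInducing.firstCountableTopology
  obtain ⟨L, -, φ, hφ, hlim⟩ := (isCompact_setOf_norm_euclideanHom_le C).tendsto_subseq
    (x := fun k => T ^ (k + 1)) hC
  have hshift : Tendsto (fun k => T ^ (φ (k + 2) + 1)) atTop (𝓝 L) :=
    hlim.comp (tendsto_add_atTop_nat 2)
  have hq : Tendsto (fun k => T⁻¹ * ((T ^ (φ k + 1))⁻¹ * T ^ (φ (k + 2) + 1))) atTop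
      (𝓝 (T⁻¹ * (L⁻¹ * L))) := (hlim.inv.mul hshift).const_mul T⁻¹
  rw [inv_mul_cancel, mul_one] at hq
  have hpow : ∀ k : ℕ, T ^ (k + 1) ∈ S := by
    intro k
    induction k with
    | zero => simpa using hT
    | succ k ih => rw [pow_succ]; exact S.mul_mem ih hT
  refine hS.mem_of_tendsto hq (Eventually.of_forall fun k => ?_)
  have h1 : φ k < φ (k + 1) := hφ (Nat.lt_succ_self k)
  have h2 : φ (k + 1) < φ (k + 2) := hφ (Nat.lt_succ_self (k + 1))
  obtain ⟨j, hj⟩ : ∃ j, φ (k + 2) = φ k + j + 2 := ⟨φ (k + 2) - φ k - 2, by omega⟩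
  have h3 : T⁻¹ * ((T ^ (φ k + 1))⁻¹ * T ^ (φ (k + 2) + 1)) = T ^ (j + 1) := by
    rw [hj, show φ k + j + 2 + 1 = (φ k + 1) + (j + 2) by ring, pow_add T (φ k + 1),
      inv_mul_cancel_left, show j + 2 = 1 + (j + 1) by ring, pow_add T 1, pow_one, inv_mul_cancel_left]
  rw [h3]
  exact hpow j

end Sphere

theorem corollary5 (n : ℕ) (S : Subsemigroup SL(n + 1, ℝ))
    (hS : IsClosed (S : Set SL(n + 1, ℝ))) :
    ActsDistallyOnSphere S ↔
      ∀ C : Subsemigroup SL(n + 1, ℝ), C ≤ S → IsCyclicSubsemigroup C → ActsDistallyOnSphere C := by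
  refine ⟨fun h C hC _ => h.mono hC, fun h => ?_⟩
  have hbdd : ∀ T ∈ S, ∃ C, ∀ k : ℕ, ‖euclideanHom n (T ^ (k + 1))‖ ≤ C := by
    intro T hT
    have hle : Subsemigroup.closure {T} ≤ S :=
      Subsemigroup.closure_le.mpr (Set.singleton_subset_iff.mpr hT)
    refine (h _ hle ⟨T, rfl⟩).bounded.imp fun C hC k => hC _ ?_
    induction k with
    | zero => simpa using Subsemigroup.subset_closure (Set.mem_singleton T)
    | succ k ih =>
      rw [pow_succ]
      exact Subsemigroup.mul_mem _ ih (Subsemigroup.subset_closure (Set.mem_singleton T))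
  have hinv : ∀ T ∈ S, T⁻¹ ∈ S := fun T hT =>
    (hbdd T hT).elim fun _ hC => inv_mem_of_bounded_powers hS hT hC
  rcases (S : Set SL(n + 1, ℝ)).eq_empty_or_nonempty with hempty | ⟨T₀, hT₀⟩
  · refine actsDistallyOnSphere_of_bounded (C := 0) fun A hA => ?_
    exact absurd (show A ∈ (S : Set SL(n + 1, ℝ)) from hA) (by simp [hempty])
  let G : Subgroup SL(n + 1, ℝ) :=
    { S with
      one_mem' := by
        have := S.mul_mem hT₀ (hinv T₀ hT₀)
        rwa [mul_inv_cancel] at this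
      inv_mem' := fun {T} hT => hinv T hT }
  obtain ⟨C, hC⟩ := exists_norm_le_of_isElliptic ((euclideanHom n).comp G.subtype) (by
      have h1 := isClosedEmbedding_euclideanHom.isClosedMap _ hS
      have h2 : Set.range ((euclideanHom n).comp G.subtype) =
          euclideanHom n '' (S : Set SL(n + 1, ℝ)) := by
        ext A
        constructor
        · rintro ⟨g, rfl⟩
          exact ⟨g, g.2, rfl⟩
        · rintro ⟨g, hg, rfl⟩
          exact ⟨⟨g, hg⟩, rfl⟩
      rwa [h2]) (by
      rintro ⟨T, hT⟩
      obtain ⟨a, ha⟩ := hbdd T hT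
      obtain ⟨b, hb⟩ := hbdd T⁻¹ (hinv T hT)
      refine weaklyBounded_toRepresentation_iff.mpr ⟨max 1 (max a b), fun m => ?_⟩
      change ‖euclideanHom n (T ^ m)‖ ≤ _
      obtain ⟨k, rfl | rfl⟩ := m.eq_nat_or_neg
      · rw [zpow_natCast]
        rcases k with _ | k
        · rw [pow_zero, map_one]
          exact ContinuousLinearMap.norm_id_le.trans (le_max_left _ _)
        · exact (ha k).trans ((le_max_left _ _).trans (le_max_right _ _))
      · rw [zpow_neg, zpow_natCast, ← inv_pow]
        rcases k with _ | k
        · rw [pow_zero, map_one]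
          exact ContinuousLinearMap.norm_id_le.trans (le_max_left _ _)
        · exact (hb k).trans ((le_max_right _ _).trans (le_max_right _ _)))
  exact actsDistallyOnSphere_of_bounded fun A hA => hC ⟨A, hA⟩
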